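/- For integers $t\ge 1$ and $n\ge 0$, let $A_t(n)$ be the number of partition pairs of $n$ with $t$-cores, that is, of ordered pairs $(\lambda,\mu)$ of partitions (the empty partition being allowed) such that the sum of all parts of $\lambda$ and $\mu$ is $n$ and both $\lambda$ and $\mu$ are $t$-cores; a partition is a $t$-core if none of the hook numbers of its Ferrers–Young diagram is divisible by $t$. Then for all integers $n\ge 0$ with $3\nmid n$ and all integers $k\ge 0$, $$A_4\left(3^{2k+1}n+\frac{3^{2k+2}-5}{4}\right)=\frac{3^{4k+4}-1}{80}\,A_4(3n+1).$$ Consequently, for all integers $n\ge 0$ with $3\nmid n$ and all integers $k\ge 0$, $$A_4\left(3^{2k+1}n+\frac{3^{2k+2}-5}{4}\right)\equiv 0\pmod{\frac{3(3^{4k+4}-1)}{40}}.$$ -/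

import Mathlib

namespace CorePairs

/-- The hook number of the cell `(i, j)` of the Young diagram `μ` (row `i`, column `j`):
the number of cells to the right of it in its row, plus the number of cells below it in its
column, plus one. -/
def hookNumber (μ : YoungDiagram) (i j : ℕ) : ℕ :=
  (μ.rowLen i - (j + 1)) + (μ.colLen j - (i + 1)) + 1

/-- A partition, given by its Young diagram, is a `t`-core if none of the hook numbers of its
cells is divisible by `t`. -/
def IsCore (t : ℕ) (μ : YoungDiagram) : Prop :=
  ∀ i j : ℕ, (i, j) ∈ μ → ¬ t ∣ hookNumber μ i j

/-- The set of partition pairs of `n` with `t`-cores: ordered pairs of `t`-core partitions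
whose parts sum to `n` altogether. -/
def corePairs (t n : ℕ) : Set (YoungDiagram × YoungDiagram) :=
  {p | p.1.card + p.2.card = n ∧ IsCore t p.1 ∧ IsCore t p.2}

/-- `A t n` is the number of partition pairs of `n` with `t`-cores. -/
noncomputable def A (t n : ℕ) : ℕ := (corePairs t n).ncard

theorem cells_subset_of_card_le {n : ℕ} {μ : YoungDiagram} (h : μ.card ≤ n) :
    μ.cells ⊆ Finset.range n ×ˢ Finset.range n := by
  rintro ⟨i, j⟩ hc
  have hc' : (i, j) ∈ μ := hc
  have h1 : μ.rowLen i ≤ μ.card := by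
    rw [YoungDiagram.rowLen_eq_card]
    exact Finset.card_le_card (Finset.filter_subset _ _)
  have h2 : μ.colLen j ≤ μ.card := by
    rw [YoungDiagram.colLen_eq_card]
    exact Finset.card_le_card (Finset.filter_subset _ _)
  have h3 := YoungDiagram.mem_iff_lt_rowLen.1 hc'
  have h4 := YoungDiagram.mem_iff_lt_colLen.1 hc'
  simp only [Finset.mem_product, Finset.mem_range]
  omega

/-- There are finitely many partition pairs of `n` with `t`-cores, so `A t n` counts them. -/
theorem corePairs_finite (t n : ℕ) : (corePairs t n).Finite := by
  have hf : {μ : YoungDiagram | μ.card ≤ n}.Finite := by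
    refine Set.Finite.of_finite_image (f := YoungDiagram.cells) ?_ ?_
    · refine ((Finset.range n ×ˢ Finset.range n).powerset.finite_toSet).subset ?_
      rintro _ ⟨μ, hμ, rfl⟩
      exact Finset.mem_coe.2 (Finset.mem_powerset.2 (cells_subset_of_card_le hμ))
    · intro μ _ ν _ h
      exact YoungDiagram.ext h
  refine (hf.prod hf).subset ?_
  rintro ⟨μ, ν⟩ ⟨h, -, -⟩
  simp only [Set.mem_prod, Set.mem_ofPred_eq] at h ⊢
  omega

end CorePairs

open Matrix

namespace CorePairs

/-! Beta numbers on a 4-runner abacus parametrize 4-cores by integer triples with even sum, the size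
being a quadratic polynomial. Completing squares for a pair of cores gives `sixtyFour_mul_A`:
64·A₄(n) counts the representations of 4n+5 by six squares, two of opposite parity and four odd. The
indices in the theorem become 9^k·3M with M = 4n+3 prime to 3.

The count is half the difference of two sums over a sphere, of `parityWeight` and `signedWeight`.
Each weight is multiplied by a sign under reflection in any vector that is isotropic modulo 3 with
entries 0, ±1. Summing over all these reflections gives `hecke_relation`, linking the sums S(9N),
S(N) and the part I(N) of S(N) carried by vectors divisible by 3. For `parityWeight` it reads S(9N)
− S(N) = 81(S(N) − I(N)). As I(9N) = S(N) and I(3M) = 0, the sum is S(3M)·(1 + 81 + … + 81^k). For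
`signedWeight` all sums vanish: at 3M because sign-reversing integral reflections pair off the terms
(`sphereSum_signedWeight_base`), then at every level by the Hecke relation.

The congruence needs 6 ∣ A₄(3n+1). Evenness comes from swapping the two cores, and negating a
parameter when they agree. For the factor 3, 3-cycles of coordinates and sign changes reduce the
count modulo 3 to a quaternary representation number of M. Four times that number counts vectors of
squared length 2M on which another 3-cycle acts without fixed points. -/

abbrev Z6 := Fin 6 → ℤ

/-- The integer vectors of squared length `N`. -/
noncomputable def sphere (N : ℤ) : Finset Z6 :=
  (Fintype.piFinset fun _ => Finset.Icc (-N) N).filter fun x => x ⬝ᵥ x = N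

theorem mem_sphere {N : ℤ} {x : Z6} : x ∈ sphere N ↔ x ⬝ᵥ x = N := by
  simp only [sphere, Finset.mem_filter, Fintype.mem_piFinset, Finset.mem_Icc,
    and_iff_right_iff_imp]
  rintro h i
  have h1 : x i * x i ≤ x ⬝ᵥ x :=
    Finset.single_le_sum (f := fun i => x i * x i) (fun j _ => mul_self_nonneg _)
      (Finset.mem_univ i)
  constructor <;> nlinarith

/-! ### Isotropic vectors modulo 3 and their enumeration -/

abbrev Tuple := ℤ × ℤ × ℤ × ℤ × ℤ × ℤ

def ofTuple (t : Tuple) : Z6 :=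
  ![t.1, t.2.1, t.2.2.1, t.2.2.2.1, t.2.2.2.2.1, t.2.2.2.2.2]

theorem ofTuple_injective : Function.Injective ofTuple := by
  rintro ⟨a, b, c, d, e, f⟩ ⟨a', b', c', d', e', f'⟩ h
  have h0 := congrFun h 0
  have h1 := congrFun h 1
  have h2 := congrFun h 2
  have h3 := congrFun h 3
  have h4 := congrFun h 4
  have h5 := congrFun h 5
  simp [ofTuple] at h0 h1 h2 h3 h4 h5
  simp_all

theorem ofTuple_surjective (x : Z6) : ofTuple (x 0, x 1, x 2, x 3, x 4, x 5) = x := by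
  ext i
  fin_cases i <;> rfl

abbrev trits : Finset ℤ := {-1, 0, 1}

def tdot (s t : Tuple) : ℤ :=
  s.1 * t.1 + s.2.1 * t.2.1 + s.2.2.1 * t.2.2.1 + s.2.2.2.1 * t.2.2.2.1 +
    s.2.2.2.2.1 * t.2.2.2.2.1 + s.2.2.2.2.2 * t.2.2.2.2.2

theorem ofTuple_dotProduct (s t : Tuple) : ofTuple s ⬝ᵥ ofTuple t = tdot s t := by
  simp [ofTuple, tdot, dotProduct, Fin.sum_univ_succ]
  ring

def isotropicTuples : Finset Tuple :=
  (trits ×ˢ trits ×ˢ trits ×ˢ trits ×ˢ trits ×ˢ trits).filter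
    fun t => tdot t t = 3 ∨ tdot t t = 6

/-- Representatives with entries in `{-1, 0, 1}` of the nonzero isotropic vectors modulo `3`
for the sum of six squares. -/
def isotropicTrits : Finset Z6 := isotropicTuples.image ofTuple

theorem mem_trits {a : ℤ} : a ∈ trits ↔ a = -1 ∨ a = 0 ∨ a = 1 := by simp [trits]

theorem mem_isotropicTrits {v : Z6} :
    v ∈ isotropicTrits ↔ (∀ i, v i = -1 ∨ v i = 0 ∨ v i = 1) ∧ (v ⬝ᵥ v = 3 ∨ v ⬝ᵥ v = 6) := by
  constructor
  · intro h
    obtain ⟨t, ht, rfl⟩ := Finset.mem_image.1 h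
    rw [ofTuple_dotProduct]
    simp only [isotropicTuples, Finset.mem_filter, Finset.mem_product, mem_trits] at ht
    obtain ⟨⟨h0, h1, h2, h3, h4, h5⟩, h⟩ := ht
    refine ⟨fun i => ?_, h⟩
    fin_cases i
    exacts [h0, h1, h2, h3, h4, h5]
  · rintro ⟨h, h'⟩
    rw [← ofTuple_surjective v] at h' ⊢
    rw [ofTuple_dotProduct] at h'
    refine Finset.mem_image_of_mem _ ?_
    simp only [isotropicTuples, Finset.mem_filter, Finset.mem_product, mem_trits]
    exact ⟨⟨h 0, h 1, h 2, h 3, h 4, h 5⟩, h'⟩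

theorem sum_isotropicTrits (g : Z6 → ℤ) :
    ∑ v ∈ isotropicTrits, g v = ∑ t ∈ isotropicTuples, g (ofTuple t) :=
  Finset.sum_image fun _ _ _ _ h => ofTuple_injective h

/-- There are C(6,3)·2³ = 160 vectors of squared length 3 and 2⁶ = 64 of squared length 6. -/
theorem card_isotropicTrits : isotropicTrits.card = 224 := by
  rw [isotropicTrits, Finset.card_image_of_injective _ ofTuple_injective]
  decide +kernel

/-- `1` on vectors of squared length `3` and `-1` on those of squared length `6`. -/
def weightSign (v : Z6) : ℤ := if v ⬝ᵥ v = 3 then 1 else -1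

theorem sum_weightSign : ∑ v ∈ isotropicTrits, weightSign v = 96 := by
  rw [sum_isotropicTrits]
  simp only [weightSign, ofTuple_dotProduct]
  decide +kernel

/-- Restricting to `u` without entry −1 keeps the kernel computation small; sign changes recover the
general case. Here 62 = 2 + 3·20: the vectors ±u, and three lifts of each of the 20 nonzero
isotropic vectors of u^⊥/u over 𝔽₃. -/
theorem card_filter_isotropicTuples :
    ∀ u ∈ isotropicTuples.filter (fun u => u.1 ≠ -1 ∧ u.2.1 ≠ -1 ∧ u.2.2.1 ≠ -1 ∧
      u.2.2.2.1 ≠ -1 ∧ u.2.2.2.2.1 ≠ -1 ∧ u.2.2.2.2.2 ≠ -1),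
      (isotropicTuples.filter fun t => 3 ∣ tdot u t).card = 62 ∧
      (isotropicTuples.filter fun t => tdot t t = 6 ∧ 3 ∣ tdot u t).card =
        if tdot u u = 3 then 16 else 22 := by
  decide +kernel

/-- The sign which makes an entry nonnegative. -/
def flip (u : Z6) (i : Fin 6) : ℤ := if u i = -1 then -1 else 1

theorem flip_mul_self (u : Z6) (i : Fin 6) : flip u i * flip u i = 1 := by
  unfold flip; split_ifs <;> rfl

theorem flip_dotProduct (u x y : Z6) :
    (fun i => flip u i * x i) ⬝ᵥ (fun i => flip u i * y i) = x ⬝ᵥ y := by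
  refine Finset.sum_congr rfl fun i _ => ?_
  linear_combination (x i * y i) * flip_mul_self u i

theorem flip_mem {u v : Z6} (h : v ∈ isotropicTrits) :
    (fun i => flip u i * v i) ∈ isotropicTrits := by
  rw [mem_isotropicTrits] at h ⊢
  rw [flip_dotProduct]
  refine ⟨fun i => ?_, h.2⟩
  have := h.1 i
  unfold flip
  split_ifs <;> grind

theorem flip_flip (u v : Z6) : (fun i => flip u i * (flip u i * v i)) = v := by
  ext i
  rw [← mul_assoc, flip_mul_self, one_mul]

/-- The predicate `p` serves both the unrestricted count and the count at squared length 6. -/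
theorem card_filter_flip (u : Z6) (p : ℤ → Prop) [DecidablePred p] :
    (isotropicTrits.filter fun v => p (v ⬝ᵥ v) ∧ 3 ∣ u ⬝ᵥ v).card =
      (isotropicTrits.filter fun v =>
        p (v ⬝ᵥ v) ∧ 3 ∣ (fun i => flip u i * u i) ⬝ᵥ v).card := by
  refine Finset.card_nbij' (fun v i => flip u i * v i) (fun v i => flip u i * v i) ?_ ?_ ?_ ?_
  · intro v hv
    simp only [Finset.coe_filter, Set.mem_ofPred_eq] at hv ⊢
    rw [flip_dotProduct, flip_dotProduct]
    exact ⟨flip_mem hv.1, hv.2⟩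
  · intro v hv
    simp only [Finset.coe_filter, Set.mem_ofPred_eq] at hv ⊢
    refine ⟨flip_mem hv.1, ?_⟩
    rw [flip_dotProduct, ← flip_dotProduct u u, flip_flip]
    exact hv.2
  · intro v _
    exact flip_flip u v
  · intro v _
    exact flip_flip u v

theorem card_filter_tuples (u : Tuple) (p : ℤ → Prop) [DecidablePred p] :
    (isotropicTrits.filter fun v => p (v ⬝ᵥ v) ∧ 3 ∣ ofTuple u ⬝ᵥ v).card =
      (isotropicTuples.filter fun t => p (tdot t t) ∧ 3 ∣ tdot u t).card := by
  rw [isotropicTrits, Finset.filter_image, Finset.card_image_of_injective _ ofTuple_injective]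
  simp only [ofTuple_dotProduct]

theorem flip_self_mem {u : Z6} (hu : u ∈ isotropicTrits) :
    ∃ t ∈ isotropicTuples.filter (fun u => u.1 ≠ -1 ∧ u.2.1 ≠ -1 ∧ u.2.2.1 ≠ -1 ∧
      u.2.2.2.1 ≠ -1 ∧ u.2.2.2.2.1 ≠ -1 ∧ u.2.2.2.2.2 ≠ -1),
      ofTuple t = (fun i => flip u i * u i) ∧ tdot t t = u ⬝ᵥ u := by
  obtain ⟨t, ht, hte⟩ := Finset.mem_image.1 (flip_mem (u := u) hu)
  refine ⟨t, Finset.mem_filter.2 ⟨ht, ?_⟩, hte, ?_⟩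
  · have key : ∀ i, ofTuple t i ≠ -1 := fun i => by
      rw [hte]
      have := (mem_isotropicTrits.1 hu).1 i
      simp only [flip]
      split_ifs <;> grind
    exact ⟨key 0, key 1, key 2, key 3, key 4, key 5⟩
  · rw [← ofTuple_dotProduct, hte, flip_dotProduct]

theorem card_orthogonal {u : Z6} (hu : u ∈ isotropicTrits) :
    (isotropicTrits.filter fun v => 3 ∣ u ⬝ᵥ v).card = 62 := by
  obtain ⟨t, ht, hte, -⟩ := flip_self_mem hu
  have h := card_filter_flip u (fun _ => True)
  rw [← hte, card_filter_tuples t (fun _ => True)] at h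
  simp only [true_and] at h
  rw [h, (card_filter_isotropicTuples t ht).1]

theorem card_orthogonal_six {u : Z6} (hu : u ∈ isotropicTrits) :
    (isotropicTrits.filter fun v => v ⬝ᵥ v = 6 ∧ 3 ∣ u ⬝ᵥ v).card =
      if u ⬝ᵥ u = 3 then 16 else 22 := by
  obtain ⟨t, ht, hte, htt⟩ := flip_self_mem hu
  have h := card_filter_flip u (fun a => a = 6)
  rw [← hte, card_filter_tuples t (fun a => a = 6)] at h
  rw [h, (card_filter_isotropicTuples t ht).2, htt]

/-! ### Balanced residues modulo 3 -/

/-- The balanced residues modulo `3` of the entries. -/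
def balanced (x : Z6) : Z6 := fun i => (x i + 1) % 3 - 1

theorem exists_eq_balanced (x : Z6) : ∃ w : Z6, x = balanced x + (3 : ℤ) • w :=
  ⟨fun i => (x i + 1) / 3, by
    ext i
    simp only [balanced, Pi.add_apply, Pi.smul_apply, smul_eq_mul]
    omega⟩

theorem balanced_trit (x : Z6) (i : Fin 6) :
    balanced x i = -1 ∨ balanced x i = 0 ∨ balanced x i = 1 := by
  simp only [balanced]
  omega

theorem dotProduct_self_expand (v w : Z6) :
    (v + (3 : ℤ) • w) ⬝ᵥ (v + (3 : ℤ) • w) = v ⬝ᵥ v + 6 * (w ⬝ᵥ v) + 9 * (w ⬝ᵥ w) := by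
  simp only [add_dotProduct, dotProduct_add, smul_dotProduct, dotProduct_smul, smul_eq_mul,
    dotProduct_comm v w]
  ring

/-- The squared length of the residue vector is a multiple of 3 between 1 and 6. -/
theorem balanced_mem {x : Z6} (hx : 3 ∣ x ⬝ᵥ x) (h0 : ¬ ∀ i, 3 ∣ x i) :
    balanced x ∈ isotropicTrits := by
  refine mem_isotropicTrits.2 ⟨balanced_trit x, ?_⟩
  obtain ⟨w, hw⟩ := exists_eq_balanced x
  have h1 := dotProduct_self_expand (balanced x) w
  rw [← hw] at h1
  have hle : ∀ i, 0 ≤ balanced x i * balanced x i ∧ balanced x i * balanced x i ≤ 1 := fun i => by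
    rcases balanced_trit x i with h | h | h <;> rw [h] <;> norm_num
  have h2 : balanced x ⬝ᵥ balanced x ≤ 6 := by
    have : balanced x ⬝ᵥ balanced x ≤ ∑ _i : Fin 6, (1 : ℤ) :=
      Finset.sum_le_sum fun i _ => (hle i).2
    simpa using this
  have h3 : 0 < balanced x ⬝ᵥ balanced x := by
    push Not at h0
    obtain ⟨i, hi⟩ := h0
    refine Finset.sum_pos' (fun i _ => (hle i).1) ⟨i, Finset.mem_univ i, ?_⟩
    have : balanced x i ≠ 0 := by
      simp only [balanced]
      omega
    exact mul_self_pos.2 this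
  omega

theorem balanced_dotProduct_dvd (x v : Z6) : 3 ∣ balanced x ⬝ᵥ v ↔ 3 ∣ x ⬝ᵥ v := by
  obtain ⟨w, hw⟩ := exists_eq_balanced x
  have : x ⬝ᵥ v = balanced x ⬝ᵥ v + 3 * (w ⬝ᵥ v) := by
    conv_lhs => rw [hw]
    simp only [add_dotProduct, smul_dotProduct, smul_eq_mul]
  omega

/-! ### Scaled reflections and their divisibility by 3 and 9 -/

/-- The factor `6 / (v ⬝ᵥ v)` for `v ∈ isotropicTrits`. -/
def reflFactor (v : Z6) : ℤ := if v ⬝ᵥ v = 3 then 2 else 1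

/-- Three times the reflection of `x` in the hyperplane orthogonal to `v`. -/
def refl (v x : Z6) : Z6 := fun i => 3 * x i - reflFactor v * (x ⬝ᵥ v) * v i

theorem refl_eq (v x : Z6) :
    refl v x = (3 : ℤ) • x - (reflFactor v * (x ⬝ᵥ v)) • v := by
  ext i
  simp [refl]

theorem reflFactor_mul {v : Z6} (hv : v ∈ isotropicTrits) : reflFactor v * (v ⬝ᵥ v) = 6 := by
  rcases (mem_isotropicTrits.1 hv).2 with h | h <;> simp [reflFactor, h]

theorem refl_dotProduct_self {v : Z6} (hv : v ∈ isotropicTrits) (x : Z6) :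
    refl v x ⬝ᵥ refl v x = 9 * (x ⬝ᵥ x) := by
  simp only [refl_eq, sub_dotProduct, dotProduct_sub, smul_dotProduct, dotProduct_smul,
    smul_eq_mul, dotProduct_comm v x]
  linear_combination (reflFactor v * (x ⬝ᵥ v) ^ 2) * reflFactor_mul hv

theorem refl_refl {v : Z6} (hv : v ∈ isotropicTrits) (x : Z6) :
    refl v (refl v x) = (9 : ℤ) • x := by
  have h : refl v x ⬝ᵥ v = -3 * (x ⬝ᵥ v) := by
    simp only [refl_eq, sub_dotProduct, smul_dotProduct, smul_eq_mul]
    linear_combination (-(x ⬝ᵥ v)) * reflFactor_mul hv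
  rw [refl_eq v (refl v x), h, refl_eq]
  ext i
  simp only [Pi.sub_apply, Pi.smul_apply, smul_eq_mul]
  ring

theorem refl_smul (v x : Z6) (c : ℤ) : refl v (c • x) = c • refl v x := by
  ext i
  simp only [refl, smul_dotProduct, Pi.smul_apply, smul_eq_mul]
  ring

theorem exists_trit_ne_zero {v : Z6} (hv : v ∈ isotropicTrits) : ∃ i, v i = 1 ∨ v i = -1 := by
  by_contra! h
  rw [mem_isotropicTrits] at hv
  have h0 : v = 0 := by
    ext i
    rcases hv.1 i with h' | h' | h'
    · exact absurd h' (h i).2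
    · exact h'
    · exact absurd h' (h i).1
  have h2 := hv.2
  simp [h0] at h2

theorem three_dvd_refl {v : Z6} (hv : v ∈ isotropicTrits) (x : Z6) :
    (∀ i, 3 ∣ refl v x i) ↔ 3 ∣ x ⬝ᵥ v := by
  constructor
  · intro h
    obtain ⟨i, hi⟩ := exists_trit_ne_zero hv
    have h1 := h i
    simp only [refl, reflFactor] at h1
    rcases hi with hi | hi <;> rw [hi] at h1 <;> split_ifs at h1 <;> omega
  · rintro ⟨c, hc⟩ i
    rw [refl, hc]
    exact ⟨x i - reflFactor v * c * v i, by ring⟩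

/-- Divisibility by 9 makes `z` congruent to a multiple of `v` modulo 3. The multiplier is a unit
since `z` is not divisible by 3, so it is ±1. -/
theorem nine_dvd_refl_imp {v z : Z6} (hv : v ∈ isotropicTrits) (hz : ¬ ∀ i, 3 ∣ z i)
    (h : ∀ i, 9 ∣ refl v z i) : v = balanced z ∨ v = -balanced z := by
  obtain ⟨c, hc⟩ := (three_dvd_refl hv z).1 fun i => (by norm_num : (3 : ℤ) ∣ 9).trans (h i)
  have key : ∀ i, 3 ∣ z i - reflFactor v * c * v i := fun i => by
    have := h i
    rw [refl, hc] at this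
    obtain ⟨d, hd⟩ := this
    exact ⟨d, by linarith⟩
  have hv1 := (mem_isotropicTrits.1 hv).1
  obtain ⟨e, he⟩ : ∃ e, e = reflFactor v * c := ⟨_, rfl⟩
  rw [← he] at key
  have he3 : ¬ 3 ∣ e := fun h3 => hz fun i =>
    (Int.dvd_iff_dvd_of_dvd_sub (key i)).2 (h3.mul_right _)
  have : e % 3 = 1 ∨ e % 3 = 2 := by omega
  rcases this with h1 | h1
  · left
    ext i
    have := key i
    simp only [balanced]
    rcases hv1 i with h2 | h2 | h2 <;> rw [h2] at this ⊢ <;> omega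
  · right
    ext i
    have := key i
    simp only [balanced, Pi.neg_apply]
    rcases hv1 i with h2 | h2 | h2 <;> rw [h2] at this ⊢ <;> omega

theorem nine_dvd_refl_balanced {z : Z6} (hz : ¬ ∀ i, 3 ∣ z i) (h9 : 9 ∣ z ⬝ᵥ z) (i : Fin 6) :
    9 ∣ refl (balanced z) z i := by
  have hv := balanced_mem ((by norm_num : (3 : ℤ) ∣ 9).trans h9) hz
  obtain ⟨w, hw⟩ := exists_eq_balanced z
  have h1 := dotProduct_self_expand (balanced z) w
  rw [← hw] at h1
  have h2 : z ⬝ᵥ balanced z = balanced z ⬝ᵥ balanced z + 3 * (w ⬝ᵥ balanced z) := by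
    have := congrArg (· ⬝ᵥ balanced z) hw
    simpa only [add_dotProduct, smul_dotProduct, smul_eq_mul] using this
  have h3 : z i = balanced z i + 3 * w i := by
    conv_lhs => rw [hw]
    simp
  -- Divisibility of the squared length by 9 fixes `w ⬝ᵥ balanced z` modulo 3: it is 1 for length 3
  -- and 2 for length 6. This makes the coefficient 3 modulo 9.
  have h4 : ∃ c, reflFactor (balanced z) * (z ⬝ᵥ balanced z) = 3 + 9 * c := by
    rcases (mem_isotropicTrits.1 hv).2 with h | h <;> simp only [reflFactor, h] at h1 h2 ⊢ <;>
      simp only [h2] <;> norm_num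
    · exact ⟨(1 + 2 * (w ⬝ᵥ balanced z)) / 3, by omega⟩
    · exact ⟨(1 + (w ⬝ᵥ balanced z)) / 3, by omega⟩
  obtain ⟨c, hc⟩ := h4
  rw [refl, hc]
  exact ⟨w i - c * balanced z i, by linear_combination 3 * h3⟩

theorem refl_neg (v x : Z6) : refl (-v) x = refl v x := by
  ext i
  simp [refl, reflFactor]

theorem neg_mem {v : Z6} (hv : v ∈ isotropicTrits) : -v ∈ isotropicTrits := by
  rw [mem_isotropicTrits] at hv ⊢
  simp only [neg_dotProduct_neg, Pi.neg_apply]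
  exact ⟨fun i => by have := hv.1 i; omega, hv.2⟩

theorem card_nine_dvd_refl {z : Z6} (hz : ¬ ∀ i, 3 ∣ z i) (h9 : 9 ∣ z ⬝ᵥ z) :
    (isotropicTrits.filter fun v => ∀ i, 9 ∣ refl v z i).card = 2 := by
  have hv := balanced_mem ((by norm_num : (3 : ℤ) ∣ 9).trans h9) hz
  have : (isotropicTrits.filter fun v => ∀ i, 9 ∣ refl v z i) =
      {balanced z, -balanced z} := by
    ext v
    simp only [Finset.mem_filter, Finset.mem_insert, Finset.mem_singleton]
    constructor
    · rintro ⟨h, h'⟩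
      exact nine_dvd_refl_imp h hz h'
    · rintro (rfl | rfl)
      · exact ⟨hv, nine_dvd_refl_balanced hz h9⟩
      · exact ⟨neg_mem hv, by rw [refl_neg]; exact nine_dvd_refl_balanced hz h9⟩
  rw [this, Finset.card_pair]
  intro h
  obtain ⟨i, hi⟩ := exists_trit_ne_zero hv
  have := congrFun h i
  simp only [Pi.neg_apply] at this
  omega

theorem card_nine_dvd_refl_smul (w : Z6) :
    (isotropicTrits.filter fun v => ∀ i, 9 ∣ refl v ((3 : ℤ) • w) i) =
      isotropicTrits.filter fun v => 3 ∣ w ⬝ᵥ v := by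
  refine Finset.filter_congr fun v hv => ?_
  rw [← three_dvd_refl hv w]
  refine forall_congr' fun i => ?_
  rw [refl_smul, Pi.smul_apply, smul_eq_mul]
  omega

/-! ### Sums over spheres and the Hecke relation at 3 -/

/-- The sum of `f` over the vectors of squared length `N`. -/
noncomputable def sphereSum (f : Z6 → ℤ) (N : ℤ) : ℤ := ∑ x ∈ sphere N, f x

/-- The sum of `f` over the vectors of squared length `N` divisible by `3`. -/
noncomputable def imprimitiveSum (f : Z6 → ℤ) (N : ℤ) : ℤ :=
  ∑ x ∈ (sphere N).filter fun x => ∀ i, 3 ∣ x i, f x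

theorem imprimitiveSum_eq_zero (f : Z6 → ℤ) {N : ℤ} (hN : ¬ 9 ∣ N) : imprimitiveSum f N = 0 := by
  rw [imprimitiveSum, Finset.filter_eq_empty_iff.2, Finset.sum_empty]
  intro x hx h
  rw [mem_sphere] at hx
  refine hN (hx ▸ Finset.dvd_sum fun i _ => ?_)
  exact mul_dvd_mul (h i) (h i)

theorem smul_mem_sphere {w : Z6} {N : ℤ} : (3 : ℤ) • w ∈ sphere (9 * N) ↔ w ∈ sphere N := by
  simp only [mem_sphere, smul_dotProduct, dotProduct_smul, smul_eq_mul]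
  omega

theorem smul_injective : Function.Injective fun w : Z6 => (3 : ℤ) • w :=
  smul_right_injective _ (by norm_num)

theorem filter_sphere_dvd (N : ℤ) :
    ((sphere (9 * N)).filter fun x => ∀ i, 3 ∣ x i) =
      (sphere N).image fun w => (3 : ℤ) • w := by
  ext x
  simp only [Finset.mem_filter, Finset.mem_image]
  constructor
  · rintro ⟨hx, h⟩
    choose w hw using h
    have hxw : x = (3 : ℤ) • w := by
      ext i
      simp [hw]
    subst hxw
    exact ⟨w, smul_mem_sphere.1 hx, rfl⟩
  · rintro ⟨w, hw, rfl⟩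
    exact ⟨smul_mem_sphere.2 hw, fun i => by simp⟩

theorem imprimitiveSum_nine_mul {f : Z6 → ℤ} (h3 : ∀ w, f ((3 : ℤ) • w) = f w) (N : ℤ) :
    imprimitiveSum f (9 * N) = sphereSum f N := by
  rw [imprimitiveSum, filter_sphere_dvd, Finset.sum_image fun _ _ _ _ h => smul_injective h]
  exact Finset.sum_congr rfl fun w _ => h3 w

/-- The scaled reflection multiplies squared length by 9 and its square is multiplication by 9, so
its inverse is itself divided by 9. -/
theorem sum_refl {v : Z6} (hv : v ∈ isotropicTrits) (f : Z6 → ℤ) (N : ℤ) :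
    ∑ x ∈ sphere N, f (refl v x) =
      ∑ z ∈ (sphere (9 * N)).filter fun z => ∀ i, 9 ∣ refl v z i, f z := by
  refine Finset.sum_nbij' (fun x => refl v x) (fun z i => refl v z i / 9) ?_ ?_ ?_ ?_ ?_
  · intro x hx
    rw [mem_sphere] at hx
    rw [Finset.mem_filter, mem_sphere, refl_dotProduct_self hv, hx, refl_refl hv]
    exact ⟨rfl, fun i => by simp⟩
  · intro z hz
    rw [Finset.mem_filter, mem_sphere] at hz
    obtain ⟨hz, h⟩ := hz
    choose w hw using h
    have h1 : (9 : ℤ) • w = refl v z := by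
      ext i
      simp [hw]
    have h2 : (fun i => refl v z i / 9) = w := by
      ext i
      simp [hw]
    have h3 := refl_dotProduct_self hv z
    rw [hz, ← h1] at h3
    simp only [smul_dotProduct, dotProduct_smul, smul_eq_mul] at h3
    rw [h2, mem_sphere]
    omega
  · intro x _
    ext i
    simp [refl_refl hv]
  · intro z hz
    rw [Finset.mem_filter, mem_sphere] at hz
    obtain ⟨hz, h⟩ := hz
    choose w hw using h
    have h1 : (9 : ℤ) • w = refl v z := by
      ext i
      simp [hw]
    have h2 : (fun i => refl v z i / 9) = w := by
      ext i
      simp [hw]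
    simp only [h2]
    have h3 : (9 : ℤ) • refl v w = (9 : ℤ) • z := by
      rw [← refl_smul, h1, refl_refl hv]
    exact smul_right_injective _ (by norm_num : (9 : ℤ) ≠ 0) h3
  · intro x _
    rfl

/-- The Hecke relation at `3` for sums over spheres of functions which are multiplied by a sign
under the reflections. -/
theorem hecke_relation {f s : Z6 → ℤ}
    (hf : ∀ v ∈ isotropicTrits, ∀ x, f (refl v x) = s v * f x)
    (h3 : ∀ w, f ((3 : ℤ) • w) = f w) {N : ℤ} (hN : 3 ∣ N) :
    (∑ v ∈ isotropicTrits, s v) * sphereSum f N =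
      2 * sphereSum f (9 * N) + 60 * sphereSum f N + 162 * imprimitiveSum f N := by
  have h1 : (∑ v ∈ isotropicTrits, s v) * sphereSum f N =
      ∑ z ∈ sphere (9 * N),
        ((isotropicTrits.filter fun v => ∀ i, 9 ∣ refl v z i).card : ℤ) * f z := by
    calc _ = ∑ v ∈ isotropicTrits, ∑ x ∈ sphere N, f (refl v x) := by
          rw [Finset.sum_mul]
          refine Finset.sum_congr rfl fun v hv => ?_
          rw [sphereSum, Finset.mul_sum]
          exact Finset.sum_congr rfl fun x _ => (hf v hv x).symm
      _ = ∑ v ∈ isotropicTrits, ∑ z ∈ sphere (9 * N),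
            if ∀ i, 9 ∣ refl v z i then f z else 0 := by
          refine Finset.sum_congr rfl fun v hv => ?_
          rw [sum_refl hv, Finset.sum_filter]
      _ = _ := by
          rw [Finset.sum_comm]
          refine Finset.sum_congr rfl fun z _ => ?_
          rw [← Finset.sum_filter, Finset.sum_const, nsmul_eq_mul]
  -- A vector not divisible by 3 is reached only through `v` equal to plus or minus its balanced
  -- residue.
  have h2 : ∑ z ∈ (sphere (9 * N)).filter (fun z => ¬ ∀ i, 3 ∣ z i),
        ((isotropicTrits.filter fun v => ∀ i, 9 ∣ refl v z i).card : ℤ) * f z =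
      2 * (sphereSum f (9 * N) - sphereSum f N) := by
    rw [← imprimitiveSum_nine_mul h3 N, sphereSum, imprimitiveSum,
      ← Finset.sum_filter_add_sum_filter_not (sphere (9 * N)) (fun z => ∀ i, 3 ∣ z i) f,
      add_sub_cancel_left, Finset.mul_sum]
    refine Finset.sum_congr rfl fun z hz => ?_
    rw [Finset.mem_filter, mem_sphere] at hz
    rw [card_nine_dvd_refl hz.2 (hz.1 ▸ dvd_mul_right 9 N)]
    rfl
  -- A vector 3w is reached through each `v` orthogonal to w modulo 3: 62 of them if w is not
  -- divisible by 3, and all 224 otherwise.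
  have h4 : ∑ z ∈ (sphere (9 * N)).filter (fun z => ∀ i, 3 ∣ z i),
        ((isotropicTrits.filter fun v => ∀ i, 9 ∣ refl v z i).card : ℤ) * f z =
      62 * (sphereSum f N - imprimitiveSum f N) + 224 * imprimitiveSum f N := by
    rw [filter_sphere_dvd, Finset.sum_image fun _ _ _ _ h => smul_injective h]
    simp only [card_nine_dvd_refl_smul, h3]
    rw [sphereSum, imprimitiveSum,
      ← Finset.sum_filter_add_sum_filter_not (sphere N) (fun z => ∀ i, 3 ∣ z i) f,
      add_sub_cancel_left,
      ← Finset.sum_filter_add_sum_filter_not (sphere N) (fun z => ∀ i, 3 ∣ z i),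
      Finset.mul_sum, Finset.mul_sum, add_comm]
    refine congrArg₂ (· + ·) ?_ ?_
    · refine Finset.sum_congr rfl fun z hz => ?_
      rw [Finset.mem_filter, mem_sphere] at hz
      have := card_orthogonal (balanced_mem (hz.1 ▸ hN) hz.2)
      simp only [balanced_dotProduct_dvd] at this
      rw [this, Nat.cast_ofNat]
    · refine Finset.sum_congr rfl fun z hz => ?_
      rw [Finset.mem_filter, mem_sphere] at hz
      rw [Finset.filter_true_of_mem, card_isotropicTrits, Nat.cast_ofNat]
      intro v _
      exact Finset.dvd_sum fun i _ => (hz.2 i).mul_right _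
  rw [h1, ← Finset.sum_filter_add_sum_filter_not (sphere (9 * N)) (fun z => ∀ i, 3 ∣ z i),
    h2, h4]
  ring

/-! ### The two parity weights and their behaviour under reflections -/

/-- The indicator function of the vectors for which `x 0 + x 1` is odd and the other entries
have the same parity. -/
def parityWeight (x : Z6) : ℤ :=
  if (x 0 + x 1) % 2 = 1 ∧ (x 2 + x 3) % 2 = 0 ∧ (x 2 + x 4) % 2 = 0 ∧ (x 2 + x 5) % 2 = 0
  then 1 else 0

/-- `parityWeight`, with a minus sign when the last four entries are odd. -/
def signedWeight (x : Z6) : ℤ := if x 2 % 2 = 0 then parityWeight x else -parityWeight x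

theorem parityWeight_congr {x y : Z6} (h : ∀ i, y i % 2 = x i % 2) :
    parityWeight y = parityWeight x := by
  have h0 := h 0
  have h1 := h 1
  have h2 := h 2
  have h3 := h 3
  have h4 := h 4
  have h5 := h 5
  unfold parityWeight
  split_ifs <;> omega

theorem parityWeight_compl {x y : Z6} (h : ∀ i, y i % 2 = (x i + 1) % 2) :
    parityWeight y = parityWeight x := by
  have h0 := h 0
  have h1 := h 1
  have h2 := h 2
  have h3 := h 3
  have h4 := h 4
  have h5 := h 5
  unfold parityWeight
  split_ifs <;> omega

theorem signedWeight_congr {x y : Z6} (h : ∀ i, y i % 2 = x i % 2) :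
    signedWeight y = signedWeight x := by
  unfold signedWeight
  rw [parityWeight_congr h, h 2]

theorem signedWeight_compl {x y : Z6} (h : ∀ i, y i % 2 = (x i + 1) % 2) :
    signedWeight y = -signedWeight x := by
  unfold signedWeight
  rw [parityWeight_compl h]
  have := h 2
  split_ifs <;> omega

theorem signedWeight_eq_zero {x : Z6} (h : parityWeight x = 0) : signedWeight x = 0 := by
  simp [signedWeight, h]

theorem parityWeight_eq_zero {x : Z6} (h : (x 0 + x 1 + x 2 + x 3 + x 4 + x 5) % 2 = 0) :
    parityWeight x = 0 := by
  unfold parityWeight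
  split_ifs <;> omega

theorem parityWeight_smul (w : Z6) : parityWeight ((3 : ℤ) • w) = parityWeight w :=
  parityWeight_congr fun i => by simp only [Pi.smul_apply, smul_eq_mul]; omega

theorem signedWeight_smul (w : Z6) : signedWeight ((3 : ℤ) • w) = signedWeight w :=
  signedWeight_congr fun i => by simp only [Pi.smul_apply, smul_eq_mul]; omega

theorem trit_of_six {v : Z6} (hv : v ∈ isotropicTrits) (h : v ⬝ᵥ v = 6) (i : Fin 6) :
    v i = 1 ∨ v i = -1 := by
  have h1 := (mem_isotropicTrits.1 hv).1
  have hle : ∀ i, v i * v i ≤ 1 := fun i => by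
    rcases h1 i with h | h | h <;> rw [h] <;> norm_num
  rcases h1 i with h2 | h2 | h2
  · exact Or.inr h2
  · exfalso
    have : v ⬝ᵥ v < ∑ _i : Fin 6, (1 : ℤ) :=
      Finset.sum_lt_sum (fun i _ => hle i) ⟨i, Finset.mem_univ i, by simp [h2]⟩
    simp [h] at this
  · exact Or.inl h2

theorem refl_mod_two_of_three {v : Z6} (h : v ⬝ᵥ v = 3) (x : Z6) (i : Fin 6) :
    refl v x i % 2 = x i % 2 := by
  rw [refl, reflFactor, if_pos h, mul_assoc]
  omega

/-- All entries of `v` are odd. On the support of `parityWeight` the coordinate sum is odd, so every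
parity is flipped there, which is the source of the sign in `signedWeight_refl`. -/
theorem refl_mod_two_of_six {v : Z6} (hv : v ∈ isotropicTrits) (h : v ⬝ᵥ v = 6) (x : Z6)
    (i : Fin 6) :
    refl v x i % 2 = (x i + (x 0 + x 1 + x 2 + x 3 + x 4 + x 5)) % 2 := by
  rw [refl, reflFactor, if_neg (by omega), one_mul]
  have key : ∀ i, ∃ c, v i = 1 + 2 * c := fun i => by
    rcases trit_of_six hv h i with h | h
    · exact ⟨0, by omega⟩
    · exact ⟨-1, by omega⟩
  choose c hc using key
  have h1 : x ⬝ᵥ v = x 0 + x 1 + x 2 + x 3 + x 4 + x 5 + 2 * (x ⬝ᵥ c) := by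
    simp only [dotProduct, Fin.sum_univ_six, hc]
    ring
  rw [hc i, mul_add, mul_one, h1]
  generalize x ⬝ᵥ c = d
  have : (x 0 + x 1 + x 2 + x 3 + x 4 + x 5 + 2 * d) * (2 * c i) =
    2 * ((x 0 + x 1 + x 2 + x 3 + x 4 + x 5 + 2 * d) * c i) := by ring
  omega

theorem parityWeight_refl {v : Z6} (hv : v ∈ isotropicTrits) (x : Z6) :
    parityWeight (refl v x) = 1 * parityWeight x := by
  rw [one_mul]
  rcases (mem_isotropicTrits.1 hv).2 with h | h
  · exact parityWeight_congr (refl_mod_two_of_three h x)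
  · have := refl_mod_two_of_six hv h x
    by_cases hx : (x 0 + x 1 + x 2 + x 3 + x 4 + x 5) % 2 = 0
    · exact parityWeight_congr fun i => by have := this i; omega
    · exact parityWeight_compl fun i => by have := this i; omega

theorem signedWeight_refl {v : Z6} (hv : v ∈ isotropicTrits) (x : Z6) :
    signedWeight (refl v x) = weightSign v * signedWeight x := by
  rcases (mem_isotropicTrits.1 hv).2 with h | h
  · rw [weightSign, if_pos h, one_mul]
    exact signedWeight_congr (refl_mod_two_of_three h x)
  · rw [weightSign, if_neg (by omega), neg_one_mul]
    have := refl_mod_two_of_six hv h x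
    by_cases hx : (x 0 + x 1 + x 2 + x 3 + x 4 + x 5) % 2 = 0
    · rw [signedWeight_eq_zero (parityWeight_eq_zero hx), signedWeight_eq_zero, neg_zero]
      rw [parityWeight_refl hv, parityWeight_eq_zero hx, mul_zero]
    · exact signedWeight_compl fun i => by have := this i; omega

/-! ### Vanishing of the signed sums -/

/-- The reflection of `x` in the hyperplane orthogonal to `v`, if it is integral. -/
def integralRefl (v x : Z6) : Z6 := fun i => refl v x i / 3

theorem smul_integralRefl {v x : Z6} (hv : v ∈ isotropicTrits) (h : 3 ∣ x ⬝ᵥ v) :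
    (3 : ℤ) • integralRefl v x = refl v x := by
  ext i
  simp only [integralRefl, Pi.smul_apply, smul_eq_mul]
  exact Int.mul_ediv_cancel' ((three_dvd_refl hv x).2 h i)

theorem refl_integralRefl {v x : Z6} (hv : v ∈ isotropicTrits) (h : 3 ∣ x ⬝ᵥ v) :
    refl v (integralRefl v x) = (3 : ℤ) • x := by
  have h1 := refl_refl hv x
  rw [← smul_integralRefl hv h, refl_smul] at h1
  ext i
  have := congrFun h1 i
  simp only [Pi.smul_apply, smul_eq_mul] at this ⊢
  omega

theorem integralRefl_dvd {v x : Z6} (hv : v ∈ isotropicTrits) (h : 3 ∣ x ⬝ᵥ v) :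
    3 ∣ integralRefl v x ⬝ᵥ v := by
  rw [← three_dvd_refl hv, refl_integralRefl hv h]
  simp

theorem integralRefl_integralRefl {v x : Z6} (hv : v ∈ isotropicTrits) (h : 3 ∣ x ⬝ᵥ v) :
    integralRefl v (integralRefl v x) = x := by
  have := smul_integralRefl hv (integralRefl_dvd hv h)
  rw [refl_integralRefl hv h] at this
  exact smul_injective this

theorem integralRefl_mem {v x : Z6} {N : ℤ} (hv : v ∈ isotropicTrits) (h : 3 ∣ x ⬝ᵥ v)
    (hx : x ∈ sphere N) : integralRefl v x ∈ sphere N := by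
  rw [← smul_mem_sphere, smul_integralRefl hv h, mem_sphere, refl_dotProduct_self hv,
    mem_sphere.1 hx]

theorem signedWeight_integralRefl {v x : Z6} (hv : v ∈ isotropicTrits) (h6 : v ⬝ᵥ v = 6)
    (h : 3 ∣ x ⬝ᵥ v) : signedWeight (integralRefl v x) = -signedWeight x := by
  rw [← signedWeight_smul, smul_integralRefl hv h, signedWeight_refl hv, weightSign,
    if_neg (by omega), neg_one_mul]

/-- On these vectors the reflection in `v` is an integral involution reversing the sign of the
weight. -/
theorem sum_signedWeight_orthogonal {v : Z6} (hv : v ∈ isotropicTrits) (h6 : v ⬝ᵥ v = 6) (N : ℤ) :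
    ∑ x ∈ (sphere N).filter fun x => 3 ∣ x ⬝ᵥ v, signedWeight x = 0 := by
  refine Finset.sum_involution (fun x _ => integralRefl v x) ?_ ?_ ?_ ?_
  · intro x hx
    rw [signedWeight_integralRefl hv h6 (Finset.mem_filter.1 hx).2, add_neg_cancel]
  · intro x hx h0 h
    have := signedWeight_integralRefl hv h6 (Finset.mem_filter.1 hx).2
    rw [h] at this
    omega
  · intro x hx
    rw [Finset.mem_filter] at hx ⊢
    exact ⟨integralRefl_mem hv hx.2 hx.1, integralRefl_dvd hv hx.2⟩
  · intro x hx
    exact integralRefl_integralRefl hv (Finset.mem_filter.1 hx).2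

theorem dotProduct_balanced (x : Z6) : ∃ w : Z6,
    x ⬝ᵥ balanced x = balanced x ⬝ᵥ balanced x + 3 * (w ⬝ᵥ balanced x) ∧
    x ⬝ᵥ x = balanced x ⬝ᵥ balanced x + 6 * (w ⬝ᵥ balanced x) + 9 * (w ⬝ᵥ w) := by
  obtain ⟨w, hw⟩ := exists_eq_balanced x
  refine ⟨w, ?_, ?_⟩
  · have := congrArg (· ⬝ᵥ balanced x) hw
    simpa only [add_dotProduct, smul_dotProduct, smul_eq_mul] using this
  · rw [← dotProduct_self_expand, ← hw]

theorem balanced_integralRefl {x : Z6} (h6 : balanced x ⬝ᵥ balanced x = 6)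
    (h9 : ¬ 9 ∣ x ⬝ᵥ x) :
    balanced (integralRefl (balanced x) x) = balanced x ∨
      balanced (integralRefl (balanced x) x) = -balanced x := by
  obtain ⟨w, h1, h2⟩ := dotProduct_balanced x
  rw [h6] at h1 h2
  obtain ⟨t, ht⟩ : ∃ t, t = w ⬝ᵥ balanced x := ⟨_, rfl⟩
  rw [← ht] at h1 h2
  have key : ∀ i, integralRefl (balanced x) x i = x i - (2 + t) * balanced x i := fun i => by
    rw [integralRefl, refl, reflFactor, if_neg (by omega), one_mul, h1]
    have : 3 * x i - (6 + 3 * t) * balanced x i = 3 * (x i - (2 + t) * balanced x i) := by ring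
    rw [this]
    omega
  -- The excluded residue 2 is exactly the case 9 ∣ x ⬝ᵥ x. Modulo 3 the reflected vector is −(1+t)
  -- times `balanced x`, hence ± it.
  have h3 : t % 3 = 0 ∨ t % 3 = 1 := by omega
  have htr := balanced_trit x
  rcases h3 with h3 | h3
  · right
    ext i
    have h4 := key i
    have h5 := htr i
    rw [balanced, h4, Pi.neg_apply]
    have h7 : balanced x i = (x i + 1) % 3 - 1 := rfl
    rcases h5 with h5 | h5 | h5 <;> rw [h5] at h7 ⊢ <;> omega
  · left
    ext i
    have h4 := key i
    have h5 := htr i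
    rw [balanced, h4]
    have h7 : balanced x i = (x i + 1) % 3 - 1 := rfl
    rcases h5 with h5 | h5 | h5 <;> rw [h5] at h7 ⊢ <;> omega

theorem integralRefl_neg (v x : Z6) : integralRefl (-v) x = integralRefl v x := by
  unfold integralRefl
  rw [refl_neg]

theorem not_forall_dvd {x : Z6} (h9 : ¬ 9 ∣ x ⬝ᵥ x) : ¬ ∀ i, 3 ∣ x i :=
  fun h => h9 (Finset.dvd_sum fun i _ => mul_dvd_mul (h i) (h i))

/-- Each vector is reflected in its own balanced residue. The image has the same residue up to sign,
so this is again a sign-reversing involution. -/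
theorem sum_signedWeight_balanced {N : ℤ} (h3 : 3 ∣ N) (h9 : ¬ 9 ∣ N) :
    ∑ x ∈ (sphere N).filter fun x => balanced x ⬝ᵥ balanced x = 6, signedWeight x = 0 := by
  have hb : ∀ x ∈ (sphere N).filter fun x => balanced x ⬝ᵥ balanced x = 6,
      balanced x ∈ isotropicTrits ∧ 3 ∣ x ⬝ᵥ balanced x ∧ ¬ 9 ∣ x ⬝ᵥ x := fun x hx => by
    rw [Finset.mem_filter, mem_sphere] at hx
    have h9' : ¬ 9 ∣ x ⬝ᵥ x := hx.1 ▸ h9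
    obtain ⟨w, hw, -⟩ := dotProduct_balanced x
    exact ⟨balanced_mem (hx.1 ▸ h3) (not_forall_dvd h9'), by omega, h9'⟩
  refine Finset.sum_involution (fun x _ => integralRefl (balanced x) x) ?_ ?_ ?_ ?_
  · intro x hx
    obtain ⟨h1, h2, -⟩ := hb x hx
    rw [signedWeight_integralRefl h1 (Finset.mem_filter.1 hx).2 h2, add_neg_cancel]
  · intro x hx h0 h
    obtain ⟨h1, h2, -⟩ := hb x hx
    have := signedWeight_integralRefl h1 (Finset.mem_filter.1 hx).2 h2
    rw [h] at this
    omega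
  · intro x hx
    obtain ⟨h1, h2, h4⟩ := hb x hx
    rw [Finset.mem_filter] at hx ⊢
    refine ⟨integralRefl_mem h1 h2 hx.1, ?_⟩
    rcases balanced_integralRefl hx.2 h4 with h | h <;> rw [h]
    · exact hx.2
    · rw [neg_dotProduct_neg, hx.2]
  · intro x hx
    obtain ⟨h1, h2, h4⟩ := hb x hx
    rcases balanced_integralRefl (Finset.mem_filter.1 hx).2 h4 with h | h <;> rw [h]
    · exact integralRefl_integralRefl h1 h2
    · rw [integralRefl_neg]
      exact integralRefl_integralRefl h1 h2

/-- Summing `sum_signedWeight_orthogonal` over `v` counts each `x` 16 or 22 times, according to the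
length of its residue. The surplus 6 falls on terms whose sum already vanishes, leaving 16 times the
full sum. -/
theorem sphereSum_signedWeight_base {N : ℤ} (h3 : 3 ∣ N) (h9 : ¬ 9 ∣ N) :
    sphereSum signedWeight N = 0 := by
  have h1 : ∑ v ∈ isotropicTrits.filter (fun v => v ⬝ᵥ v = 6),
      ∑ x ∈ sphere N, (if 3 ∣ x ⬝ᵥ v then signedWeight x else 0) = 0 := by
    refine Finset.sum_eq_zero fun v hv => ?_
    rw [Finset.mem_filter] at hv
    rw [← Finset.sum_filter, sum_signedWeight_orthogonal hv.1 hv.2]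
  rw [Finset.sum_comm] at h1
  have h2 : ∀ x ∈ sphere N, ∑ v ∈ isotropicTrits.filter (fun v => v ⬝ᵥ v = 6),
      (if 3 ∣ x ⬝ᵥ v then signedWeight x else 0) =
      16 * signedWeight x + 6 * if balanced x ⬝ᵥ balanced x = 6 then signedWeight x else 0 := by
    intro x hx
    rw [mem_sphere] at hx
    have hb := balanced_mem (hx ▸ h3) (not_forall_dvd (hx ▸ h9))
    have h4 := card_orthogonal_six hb
    simp only [balanced_dotProduct_dvd] at h4
    rw [← Finset.sum_filter, Finset.filter_filter, Finset.sum_const, h4, nsmul_eq_mul]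
    rcases (mem_isotropicTrits.1 hb).2 with h | h <;> simp [h]
    ring
  rw [Finset.sum_congr rfl h2, Finset.sum_add_distrib, ← Finset.mul_sum, ← Finset.mul_sum,
    ← Finset.sum_filter, sum_signedWeight_balanced h3 h9] at h1
  unfold sphereSum
  omega

/-! ### The recurrence for the six-square counts -/

theorem sphereSum_signedWeight_eq_zero {M : ℤ} (hM : ¬ 3 ∣ M) (k : ℕ) :
    sphereSum signedWeight (9 ^ k * (3 * M)) = 0 ∧
      imprimitiveSum signedWeight (9 ^ k * (3 * M)) = 0 := by
  induction k with
  | zero =>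
    rw [pow_zero, one_mul]
    exact ⟨sphereSum_signedWeight_base (dvd_mul_right 3 M) (by omega),
      imprimitiveSum_eq_zero _ (by omega)⟩
  | succ k ih =>
    have h := hecke_relation (fun v hv x => signedWeight_refl hv x) signedWeight_smul
      (N := 9 ^ k * (3 * M)) ((dvd_mul_right 3 M).mul_left _)
    rw [sum_weightSign, ih.1, ih.2] at h
    rw [pow_succ', mul_assoc, imprimitiveSum_nine_mul signedWeight_smul]
    exact ⟨by omega, ih.1⟩

/-- The second clause drives the induction: the part not divisible by 3 grows by 81 at each step,
and the first clause is the resulting geometric sum. -/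
theorem sphereSum_parityWeight {M : ℤ} (hM : ¬ 3 ∣ M) (k : ℕ) :
    80 * sphereSum parityWeight (9 ^ k * (3 * M)) =
        (81 ^ (k + 1) - 1) * sphereSum parityWeight (3 * M) ∧
      sphereSum parityWeight (9 ^ k * (3 * M)) - imprimitiveSum parityWeight (9 ^ k * (3 * M)) =
        81 ^ k * sphereSum parityWeight (3 * M) := by
  induction k with
  | zero =>
    rw [pow_zero, one_mul, imprimitiveSum_eq_zero _ (by omega)]
    exact ⟨by norm_num, by norm_num⟩
  | succ k ih =>
    have h := hecke_relation (s := fun _ => 1) (fun v hv x => parityWeight_refl hv x)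
      parityWeight_smul (N := 9 ^ k * (3 * M)) ((dvd_mul_right 3 M).mul_left _)
    rw [Finset.sum_const, card_isotropicTrits, nsmul_eq_mul] at h
    rw [pow_succ' 9, mul_assoc, imprimitiveSum_nine_mul parityWeight_smul]
    obtain ⟨h1, h2⟩ := ih
    push_cast at h
    have h3 : sphereSum parityWeight (9 * (9 ^ k * (3 * M))) =
        sphereSum parityWeight (9 ^ k * (3 * M)) +
          81 ^ (k + 1) * sphereSum parityWeight (3 * M) := by
      rw [pow_succ]
      linarith
    rw [h3]
    constructor
    · rw [pow_succ 81 (k + 1)]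
      linear_combination h1
    · ring

/-- The number of representations of `N` by six squares, the first two of different parity
and the other four odd. -/
noncomputable def oddSixSquares (N : ℤ) : ℕ :=
  ((sphere N).filter fun x => (x 0 + x 1) % 2 = 1 ∧ x 2 % 2 = 1 ∧ x 3 % 2 = 1 ∧
    x 4 % 2 = 1 ∧ x 5 % 2 = 1).card

theorem two_mul_oddSixSquares (N : ℤ) :
    2 * (oddSixSquares N : ℤ) = sphereSum parityWeight N - sphereSum signedWeight N := by
  rw [oddSixSquares, Finset.card_filter, Nat.cast_sum, Finset.mul_sum, sphereSum, sphereSum,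
    ← Finset.sum_sub_distrib]
  refine Finset.sum_congr rfl fun x _ => ?_
  unfold signedWeight parityWeight
  split_ifs <;> simp <;> omega

theorem oddSixSquares_recurrence {M : ℤ} (hM : ¬ 3 ∣ M) (k : ℕ) :
    80 * (oddSixSquares (9 ^ k * (3 * M)) : ℤ) = (81 ^ (k + 1) - 1) * oddSixSquares (3 * M) := by
  have h1 := two_mul_oddSixSquares (9 ^ k * (3 * M))
  have h2 := two_mul_oddSixSquares (3 * M)
  have h3 := (sphereSum_signedWeight_eq_zero hM 0).1
  rw [pow_zero, one_mul] at h3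
  rw [(sphereSum_signedWeight_eq_zero hM k).1] at h1
  rw [h3] at h2
  have h4 := (sphereSum_parityWeight hM k).1
  have h5 : 2 * (80 * (oddSixSquares (9 ^ k * (3 * M)) : ℤ)) =
      2 * ((81 ^ (k + 1) - 1) * oddSixSquares (3 * M)) := by
    linear_combination 80 * h1 + h4 - (81 ^ (k + 1) - 1) * h2
  omega

/-! ### Beta numbers, cores and the 4-runner abacus -/

/-- The beta numbers of a Young diagram. -/
def bead (μ : YoungDiagram) (i : ℕ) : ℤ := μ.rowLen i - i

/-- The complementary beta numbers, indexed by columns. -/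
def gap (μ : YoungDiagram) (j : ℕ) : ℤ := j + 1 - μ.colLen j

theorem mem_iff_gap_lt_bead {μ : YoungDiagram} {i j : ℕ} :
    (i, j) ∈ μ ↔ gap μ j < bead μ i := by
  have h1 := YoungDiagram.mem_iff_lt_rowLen (μ := μ) (i := i) (j := j)
  have h2 := YoungDiagram.mem_iff_lt_colLen (μ := μ) (i := i) (j := j)
  unfold bead gap
  constructor
  · intro h
    have := h1.1 h
    have := h2.1 h
    omega
  · intro h
    by_contra h'
    rw [h1] at h2
    rw [h1] at h'
    omega

theorem bead_ne_gap (μ : YoungDiagram) (i j : ℕ) : bead μ i ≠ gap μ j := by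
  have h1 := YoungDiagram.mem_iff_lt_rowLen (μ := μ) (i := i) (j := j)
  have h2 := YoungDiagram.mem_iff_lt_colLen (μ := μ) (i := i) (j := j)
  rw [h1] at h2
  unfold bead gap
  omega

theorem hookNumber_eq {μ : YoungDiagram} {i j : ℕ} (h : (i, j) ∈ μ) :
    (hookNumber μ i j : ℤ) = bead μ i - gap μ j := by
  have h1 := YoungDiagram.mem_iff_lt_rowLen.1 h
  have h2 := YoungDiagram.mem_iff_lt_colLen.1 h
  unfold hookNumber bead gap
  omega

theorem bead_strictAnti (μ : YoungDiagram) : StrictAnti (bead μ) := by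
  intro i j h
  have := μ.rowLen_anti i j h.le
  unfold bead
  omega

theorem rowLen_eq_zero {μ : YoungDiagram} {i : ℕ} (h : μ.colLen 0 ≤ i) : μ.rowLen i = 0 := by
  by_contra h0
  have h1 : (i, 0) ∈ μ := YoungDiagram.mem_iff_lt_rowLen.2 (Nat.pos_of_ne_zero h0)
  have := YoungDiagram.mem_iff_lt_colLen.1 h1
  omega

theorem bead_of_le {μ : YoungDiagram} {i : ℕ} (h : μ.colLen 0 ≤ i) : bead μ i = -i := by
  rw [bead, rowLen_eq_zero h]
  simp

theorem mem_range_bead_of_le {μ : YoungDiagram} {m : ℤ} (h : m ≤ -μ.colLen 0) :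
    m ∈ Set.range (bead μ) :=
  ⟨m.natAbs, by rw [bead_of_le] <;> omega⟩

theorem exists_gap_eq {μ : YoungDiagram} {m : ℤ} (h : m ∉ Set.range (bead μ)) :
    ∃ j, gap μ j = m := by
  have hex : ∃ i, bead μ i < m := by
    refine ⟨μ.colLen 0 + m.natAbs + 1, ?_⟩
    rw [bead_of_le (by omega)]
    omega
  classical
  -- Exactly `i` beads exceed `m`, so the column at `m - 1 + i` has length `i` and its gap is `m`.
  obtain ⟨i, hi, hmin⟩ : ∃ i, bead μ i < m ∧ ∀ i' < i, m < bead μ i' := by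
    refine ⟨Nat.find hex, Nat.find_spec hex, fun i' hi' => ?_⟩
    have h1 := Nat.find_min hex hi'
    have h2 : bead μ i' ≠ m := fun h2 => h ⟨i', h2⟩
    omega
  have hj : 0 ≤ m - 1 + i := by
    unfold bead at hi
    omega
  refine ⟨(m - 1 + i).toNat, ?_⟩
  have hcol : μ.colLen (m - 1 + i).toNat = i := by
    refine le_antisymm ?_ ?_
    · by_contra! hlt
      have := YoungDiagram.mem_iff_lt_rowLen.1 (YoungDiagram.mem_iff_lt_colLen.2 hlt)
      unfold bead at hi
      omega
    · rcases Nat.eq_zero_or_pos i with rfl | hpos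
      · exact Nat.zero_le _
      · have h1 := hmin (i - 1) (by omega)
        have h2 : (m - 1 + i).toNat < μ.rowLen (i - 1) := by
          unfold bead at h1
          omega
        have := YoungDiagram.mem_iff_lt_colLen.1 (YoungDiagram.mem_iff_lt_rowLen.2 h2)
        omega
  rw [gap, hcol]
  omega

/-- A partition is a `t`-core if and only if its set of beta numbers is closed under
subtracting `t`. -/
theorem isCore_iff {t : ℕ} (ht : 0 < t) (μ : YoungDiagram) :
    IsCore t μ ↔ ∀ m ∈ Set.range (bead μ), m - t ∈ Set.range (bead μ) := by
  constructor
  · rintro h _ ⟨i, rfl⟩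
    by_contra hn
    obtain ⟨j, hj⟩ := exists_gap_eq hn
    have hm : (i, j) ∈ μ := mem_iff_gap_lt_bead.2 (by omega)
    refine h i j hm ?_
    have := hookNumber_eq hm
    rw [hj] at this
    exact ⟨1, by omega⟩
  · rintro h i j hm ⟨k, hk⟩
    have h1 : ∀ k : ℕ, bead μ i - t * k ∈ Set.range (bead μ) := by
      intro k
      induction k with
      | zero => simp
      | succ k ih =>
        have := h _ ih
        rwa [sub_sub, ← mul_add_one, ← Nat.cast_succ] at this
    obtain ⟨i', hi'⟩ := h1 k
    refine bead_ne_gap μ i' j ?_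
    have := hookNumber_eq hm
    rw [hk] at this
    push_cast at this
    rw [hi']
    linarith

theorem range_bead_injective {μ ν : YoungDiagram}
    (h : Set.range (bead μ) = Set.range (bead ν)) : μ = ν := by
  have h1 : StrictMono fun i => -bead μ i := fun _ _ h => neg_lt_neg (bead_strictAnti μ h)
  have h2 : StrictMono fun i => -bead ν i := fun _ _ h => neg_lt_neg (bead_strictAnti ν h)
  have h3 : Set.range (fun i => -bead μ i) = Set.range fun i => -bead ν i := by
    have e1 : (fun i => -bead μ i) = (fun m => -m) ∘ bead μ := rfl
    have e2 : (fun i => -bead ν i) = (fun m => -m) ∘ bead ν := rfl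
    rw [e1, e2, Set.range_comp, Set.range_comp, h]
  have h4 := (h1.range_inj h2).1 h3
  ext ⟨i, j⟩
  have h5 := congrFun h4 i
  simp only [bead] at h5
  rw [YoungDiagram.mem_cells, YoungDiagram.mem_cells, YoungDiagram.mem_iff_lt_rowLen,
    YoungDiagram.mem_iff_lt_rowLen]
  omega

theorem card_eq_sum_rowLen {μ : YoungDiagram} {M : ℕ} (h : μ.colLen 0 ≤ M) :
    μ.card = ∑ i ∈ Finset.range M, μ.rowLen i := by
  rw [YoungDiagram.card, Finset.card_eq_sum_card_fiberwise (f := Prod.fst) (t := Finset.range M)]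
  · refine Finset.sum_congr rfl fun i _ => ?_
    rw [YoungDiagram.rowLen_eq_card]
    rfl
  · rintro ⟨i, j⟩ hij
    have h0 : (i, 0) ∈ μ := μ.up_left_mem le_rfl (Nat.zero_le j) hij
    have := YoungDiagram.mem_iff_lt_colLen.1 h0
    simp only [Finset.coe_range, Set.mem_Iio]
    omega

/-- `n j` is the number of beads, relative to the ground state, in the `j`-th runner of the
`4`-abacus of `μ`. -/
def IsAbacus (μ : YoungDiagram) (n : Fin 4 → ℤ) : Prop :=
  ∀ (k : ℤ) (j : Fin 4), 4 * k + (j + 1) ∈ Set.range (bead μ) ↔ k < n j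

theorem exists_isAbacus {μ : YoungDiagram} (h : IsCore 4 μ) : ∃ n, IsAbacus μ n := by
  rw [isCore_iff (by norm_num)] at h
  have key : ∀ j : Fin 4, ∃ n : ℤ, ∀ k : ℤ,
      4 * k + (j + 1) ∈ Set.range (bead μ) ↔ k < n := by
    intro j
    obtain ⟨b, hb, hmax⟩ := Int.exists_greatest_of_bdd
      (P := fun k : ℤ => 4 * k + ((j : ℕ) + 1) ∈ Set.range (bead μ))
      ⟨μ.rowLen 0, by
        rintro z ⟨i, hi⟩
        have := μ.rowLen_anti 0 i (Nat.zero_le i)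
        unfold bead at hi
        omega⟩
      ⟨-μ.colLen 0 - 1, mem_range_bead_of_le (by omega)⟩
    refine ⟨b + 1, fun k => ⟨fun hk => Int.lt_add_one_of_le (hmax k hk), fun hk => ?_⟩⟩
    have hdown : ∀ d : ℕ, 4 * (b - d) + ((j : ℕ) + 1) ∈ Set.range (bead μ) := by
      intro d
      induction d with
      | zero => simpa using hb
      | succ d ih =>
        have := h _ ih
        convert this using 1
        push_cast
        ring
    have := hdown (b - k).toNat
    rwa [Int.toNat_of_nonneg (by omega), sub_sub_cancel] at this
  choose n hn using key
  exact ⟨n, fun k j => hn j k⟩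

theorem IsAbacus.isCore {μ : YoungDiagram} {n : Fin 4 → ℤ} (h : IsAbacus μ n) : IsCore 4 μ := by
  rw [isCore_iff (by norm_num)]
  intro m hm
  obtain ⟨k, j, rfl⟩ : ∃ (k : ℤ) (j : Fin 4), m = 4 * k + (j + 1) :=
    ⟨(m - 1) / 4, ⟨((m - 1) % 4).toNat, by omega⟩, by simp only; omega⟩
  have h1 := (h k j).1 hm
  have h2 := (h (k - 1) j).2 (by omega)
  convert h2 using 1
  push_cast
  ring

/-- The beads above `-4 * K` on an abacus with four runners. -/
noncomputable def abacusBeads (n : Fin 4 → ℤ) (K : ℕ) : Finset ℤ :=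
  (Finset.univ.sigma fun j => Finset.Ico (-K : ℤ) (n j)).image
    fun p : (_ : Fin 4) × ℤ => 4 * p.2 + (p.1 + 1)

theorem abacus_injective :
    Function.Injective fun p : (_ : Fin 4) × ℤ => 4 * p.2 + ((p.1 : ℤ) + 1) := by
  rintro ⟨j, k⟩ ⟨j', k'⟩ h
  simp only at h
  have hj := j.isLt
  have hj' := j'.isLt
  have h1 : k = k' := by omega
  have h2 : j = j' := Fin.ext (by omega)
  rw [h1, h2]

theorem mem_abacusBeads {n : Fin 4 → ℤ} {K : ℕ} {k : ℤ} {j : Fin 4} :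
    4 * k + (j + 1) ∈ abacusBeads n K ↔ -K ≤ k ∧ k < n j := by
  constructor
  · intro h
    obtain ⟨p, hp, he⟩ := Finset.mem_image.1 h
    have := abacus_injective (a₁ := p) (a₂ := ⟨j, k⟩) he
    subst this
    simpa using hp
  · intro h
    exact Finset.mem_image.2 ⟨⟨j, k⟩, by simpa using h, rfl⟩

theorem exists_runner (m : ℤ) : ∃ (k : ℤ) (j : Fin 4), m = 4 * k + (j + 1) :=
  ⟨(m - 1) / 4, ⟨((m - 1) % 4).toNat, by omega⟩, by simp only; omega⟩

theorem le_of_mem_abacusBeads {n : Fin 4 → ℤ} {K : ℕ} {m : ℤ} (h : m ∈ abacusBeads n K) :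
    -(4 * K) + 1 ≤ m := by
  obtain ⟨k, j, rfl⟩ := exists_runner m
  have := mem_abacusBeads.1 h
  omega

theorem card_abacusBeads {n : Fin 4 → ℤ} {K : ℕ} (hK : ∀ j, -K ≤ n j) :
    ((abacusBeads n K).card : ℤ) = ∑ j, (n j + K) := by
  rw [abacusBeads, Finset.card_image_of_injective _ abacus_injective, Finset.card_sigma,
    Nat.cast_sum]
  refine Finset.sum_congr rfl fun j _ => ?_
  have := hK j
  rw [Int.card_Ico]
  omega

theorem two_mul_sum_Ico {a b : ℤ} (h : a ≤ b) :
    2 * ∑ k ∈ Finset.Ico a b, k = b * (b - 1) - a * (a - 1) := by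
  induction b, h using Int.leInduction with
  | base => simp
  | succ b h ih =>
    have : Finset.Ico a (b + 1) = insert b (Finset.Ico a b) := by
      ext k
      simp only [Finset.mem_insert, Finset.mem_Ico]
      omega
    rw [this, Finset.sum_insert (by simp), mul_add, ih]
    ring

theorem sum_abacusBeads {n : Fin 4 → ℤ} {K : ℕ} (hK : ∀ j, -K ≤ n j) :
    ∑ m ∈ abacusBeads n K, m =
      ∑ j, (2 * (n j * (n j - 1) - K * (K + 1)) + (j + 1) * (n j + K)) := by
  rw [abacusBeads, Finset.sum_image fun _ _ _ _ h => abacus_injective h, Finset.sum_sigma]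
  refine Finset.sum_congr rfl fun j _ => ?_
  have h1 := two_mul_sum_Ico (hK j)
  have h2 : (((Finset.Ico (-K : ℤ) (n j)).card : ℕ) : ℤ) = n j + K := by
    have := hK j
    rw [Int.card_Ico]
    omega
  dsimp only
  rw [Finset.sum_add_distrib, ← Finset.mul_sum, Finset.sum_const, nsmul_eq_mul, h2]
  linear_combination 2 * h1

theorem IsAbacus.image_bead {μ : YoungDiagram} {n : Fin 4 → ℤ} (h : IsAbacus μ n) {K : ℕ}
    (hK : μ.colLen 0 ≤ 4 * K) :
    (Finset.range (4 * K)).image (bead μ) = abacusBeads n K := by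
  ext m
  obtain ⟨k, j, rfl⟩ := exists_runner m
  rw [mem_abacusBeads, ← h k j, Finset.mem_image]
  constructor
  · rintro ⟨i, hi, he⟩
    refine ⟨?_, i, he⟩
    rw [Finset.mem_range] at hi
    unfold bead at he
    omega
  · rintro ⟨h1, i, he⟩
    refine ⟨i, Finset.mem_range.2 ?_, he⟩
    by_contra! h2
    rw [bead_of_le (by omega)] at he
    omega

theorem IsAbacus.exists_bound {μ : YoungDiagram} {n : Fin 4 → ℤ} (h : IsAbacus μ n) :
    ∃ K : ℕ, μ.colLen 0 ≤ 4 * K ∧ ∀ j, -K ≤ n j := by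
  refine ⟨μ.colLen 0 + 1, by omega, fun j => ?_⟩
  have := (h (-(μ.colLen 0) - 1) j).1 (mem_range_bead_of_le (by omega))
  push_cast
  omega

/-- The beads above −4K number 4K when K is large; counting them runner by runner gives the sum of
the `n j` plus 4K. -/
theorem IsAbacus.sum_eq_zero {μ : YoungDiagram} {n : Fin 4 → ℤ} (h : IsAbacus μ n) :
    n 0 + n 1 + n 2 + n 3 = 0 := by
  obtain ⟨K, hK, hn⟩ := h.exists_bound
  have h1 := card_abacusBeads hn
  rw [← h.image_bead hK, Finset.card_image_of_injective _ (bead_strictAnti μ).injective,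
    Finset.card_range, Fin.sum_univ_four] at h1
  push_cast at h1
  omega

/-- The sum of the first 4K beads is evaluated by rows and by runners; the terms in K cancel. -/
theorem IsAbacus.card_eq {μ : YoungDiagram} {n : Fin 4 → ℤ} (h : IsAbacus μ n) :
    (μ.card : ℤ) = 2 * (n 0 ^ 2 + n 1 ^ 2 + n 2 ^ 2 + n 3 ^ 2) + n 1 + 2 * n 2 + 3 * n 3 := by
  obtain ⟨K, hK, hn⟩ := h.exists_bound
  have h1 := sum_abacusBeads hn
  rw [← h.image_bead hK, Finset.sum_image fun _ _ _ _ h => (bead_strictAnti μ).injective h,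
    Fin.sum_univ_four] at h1
  simp only [bead, Finset.sum_sub_distrib] at h1
  rw [← Nat.cast_sum, ← Nat.cast_sum, ← card_eq_sum_rowLen hK] at h1
  have h2 := Finset.sum_range_id_mul_two (4 * K)
  have h3 : ((∑ i ∈ Finset.range (4 * K), i : ℕ) : ℤ) = 2 * K * (4 * K - 1) := by
    rcases Nat.eq_zero_or_pos K with rfl | hpos
    · simp
    · zify [show 1 ≤ 4 * K by omega] at h2
      push_cast
      linarith
  rw [h3] at h1
  have h4 := h.sum_eq_zero
  norm_num [Fin.val_two] at h1
  linear_combination h1 - h4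

theorem IsAbacus.eq_of_eq {μ ν : YoungDiagram} {n : Fin 4 → ℤ} (h : IsAbacus μ n)
    (h' : IsAbacus ν n) : μ = ν := by
  refine range_bead_injective (Set.ext fun m => ?_)
  obtain ⟨k, j, rfl⟩ := exists_runner m
  rw [h k j, h' k j]

theorem IsAbacus.unique {μ : YoungDiagram} {n n' : Fin 4 → ℤ} (h : IsAbacus μ n)
    (h' : IsAbacus μ n') : n = n' := by
  ext j
  have h1 := (h (n j) j).symm.trans (h' (n j) j)
  have h2 := (h (n' j) j).symm.trans (h' (n' j) j)
  omega

/-! ### Reconstructing a diagram from its beads -/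

/-- The number of elements of `F` which are at least `m`. -/
def countGE (F : Finset ℤ) (m : ℤ) : ℕ := (F.filter fun x => m ≤ x).card

theorem countGE_anti (F : Finset ℤ) {m m' : ℤ} (h : m ≤ m') : countGE F m' ≤ countGE F m :=
  Finset.card_le_card fun x hx => by
    rw [Finset.mem_filter] at hx ⊢
    exact ⟨hx.1, h.trans hx.2⟩

theorem countGE_succ (F : Finset ℤ) (m : ℤ) :
    countGE F m = countGE F (m + 1) + if m ∈ F then 1 else 0 := by
  have : (F.filter fun x => m ≤ x) = (F.filter fun x => m + 1 ≤ x) ∪ F.filter fun x => x = m := by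
    ext x
    simp only [Finset.mem_union, Finset.mem_filter]
    by_cases hx : x ∈ F
    · simp only [hx, true_and]
      omega
    · simp [hx]
  rw [countGE, this, Finset.card_union_of_disjoint]
  · congr 1
    rw [Finset.filter_eq']
    split_ifs <;> rfl
  · rw [Finset.disjoint_left]
    intro x h1 h2
    have h3 := (Finset.mem_filter.1 h1).2
    have h4 := (Finset.mem_filter.1 h2).2
    omega

theorem countGE_le (F : Finset ℤ) (m : ℤ) : countGE F m ≤ F.card :=
  Finset.card_filter_le _ _

theorem le_countGE {F : Finset ℤ} {a : ℤ} (h : ∀ x ∈ F, 1 - a ≤ x) (hc : F.card = a) {m : ℤ}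
    (hm : 1 - a ≤ m) : 1 - m ≤ countGE F m := by
  have h1 : (F.filter fun x => ¬ m ≤ x).card ≤ (Finset.Ico (1 - a) m).card :=
    Finset.card_le_card fun x hx => by
      rw [Finset.mem_filter] at hx
      rw [Finset.mem_Ico]
      exact ⟨h x hx.1, by omega⟩
  have h2 := Finset.card_filter_add_card_filter_not (s := F) (fun x => m ≤ x)
  rw [Int.card_Ico] at h1
  unfold countGE
  omega

/-- The Young diagram with a given set of beads above `-M`, of which there are `M`. -/
noncomputable def diagramOfBeads (F : Finset ℤ) (M : ℕ) : YoungDiagram where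
  cells := (Finset.range M ×ˢ Finset.range (2 * M)).filter
    -- Row i is longer than j exactly when the bead of index i, in decreasing order from 0, is at
    -- least j − i + 1.
    fun p => p.1 < countGE F (p.2 - p.1 + 1)
  isLowerSet := by
    rintro ⟨i, j⟩ ⟨i', j'⟩ ⟨hi, hj⟩ h
    simp only [Finset.coe_filter, Finset.mem_product, Finset.mem_range, Set.mem_ofPred_eq] at h ⊢
    simp only at hi hj
    refine ⟨by omega, ?_⟩
    have h1 := countGE_anti F (m := j' - i + 1) (m' := j - i + 1) (by omega)
    -- Raising the threshold by one loses at most one bead, so moving up a row preserves membership.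
    have h2 : ∀ d : ℕ, countGE F (j' - i + 1) ≤ countGE F (j' - i + 1 + d) + d := by
      intro d
      induction d with
      | zero => simp
      | succ d ih =>
        have := countGE_succ F (j' - i + 1 + d)
        rw [Nat.cast_succ, ← add_assoc (_ - _ + _ : ℤ)]
        split_ifs at this <;> omega
    have h3 := h2 (i - i')
    have h4 : (j' - i + 1 + ((i - i' : ℕ) : ℤ)) = j' - i' + 1 := by omega
    rw [h4] at h3
    omega

theorem lt_rowLen_diagramOfBeads {F : Finset ℤ} {M : ℕ} (hc : F.card = M)
    (hM : ∀ x ∈ F, x ≤ M) {i j : ℕ} :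
    j < (diagramOfBeads F M).rowLen i ↔ i < countGE F (j - i + 1) := by
  rw [← YoungDiagram.mem_iff_lt_rowLen, ← YoungDiagram.mem_cells]
  simp only [diagramOfBeads, Finset.mem_filter, Finset.mem_product, Finset.mem_range,
    and_iff_right_iff_imp]
  intro h
  have h1 := countGE_le F (j - i + 1)
  refine ⟨by omega, ?_⟩
  obtain ⟨x, hx⟩ := Finset.card_pos.1 (Nat.zero_lt_of_lt h)
  rw [Finset.mem_filter] at hx
  have := hM x hx.1
  omega

theorem range_bead_diagramOfBeads {F : Finset ℤ} {M : ℕ} (hc : F.card = M)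
    (hM : ∀ x ∈ F, x ≤ M) (hM' : ∀ x ∈ F, 1 - (M : ℤ) ≤ x) (m : ℤ) :
    m ∈ Set.range (bead (diagramOfBeads F M)) ↔ m ∈ F ∨ m ≤ -M := by
  have hlt := @lt_rowLen_diagramOfBeads F M hc hM
  have hge : ∀ i, M ≤ i → (diagramOfBeads F M).rowLen i = 0 := fun i hi => by
    by_contra h0
    have h1 := hlt.1 (Nat.pos_of_ne_zero h0)
    have := countGE_le F ((0 : ℕ) - i + 1)
    omega
  have hc' : (F.card : ℤ) = M := by exact_mod_cast hc
  constructor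
  · rintro ⟨i, rfl⟩
    rcases le_or_gt M i with hi | hi
    · right
      rw [bead, hge i hi]
      omega
    · left
      by_contra hF
      have h1 := countGE_succ F (bead (diagramOfBeads F M) i)
      rw [if_neg hF, add_zero] at h1
      obtain ⟨r, hr⟩ : ∃ r, r = (diagramOfBeads F M).rowLen i := ⟨_, rfl⟩
      rw [bead, ← hr] at h1
      have h2 := hlt (i := i) (j := r)
      rw [← hr, ← h1] at h2
      rcases Nat.eq_zero_or_pos r with h0 | h0
      · have := le_countGE hM' hc' (m := (r : ℤ) - i) (by omega)
        omega
      · have h3 := hlt (i := i) (j := r - 1)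
        rw [← hr, show ((r - 1 : ℕ) : ℤ) - i + 1 = r - i by omega] at h3
        omega
  · rintro (hF | hm)
    · have h1 := countGE_succ F m
      rw [if_pos hF] at h1
      have h2 := hM' m hF
      have h3 := le_countGE hM' hc' h2
      obtain ⟨i, hi⟩ : ∃ i, i = countGE F (m + 1) := ⟨_, rfl⟩
      refine ⟨i, ?_⟩
      have h4 : (diagramOfBeads F M).rowLen i = (m + i).toNat := by
        refine le_antisymm ?_ ?_
        · by_contra! h5
          have h6 := hlt.1 h5
          have := countGE_anti F (m := m + 1) (m' := ((m + i).toNat : ℤ) - i + 1) (by omega)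
          omega
        · rcases Nat.eq_zero_or_pos (m + i).toNat with h0 | h0
          · omega
          · have h6 := countGE_anti F (m := (((m + i).toNat - 1 : ℕ) : ℤ) - i + 1) (m' := m)
              (by omega)
            have := hlt.2 (show i < _ by omega : i < countGE F
              ((((m + i).toNat - 1 : ℕ) : ℤ) - i + 1))
            omega
      rw [bead, h4]
      omega
    · refine ⟨m.natAbs, ?_⟩
      rw [bead, hge _ (by omega)]
      omega

theorem exists_isAbacus_of_sum_eq_zero {n : Fin 4 → ℤ} (h : n 0 + n 1 + n 2 + n 3 = 0) :
    ∃ μ, IsAbacus μ n := by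
  obtain ⟨K, hK⟩ : ∃ K : ℕ, ∀ j, -K ≤ n j ∧ n j ≤ K := by
    refine ⟨∑ j, (n j).natAbs, fun j => ?_⟩
    have := Finset.single_le_sum (f := fun j => (n j).natAbs) (fun _ _ => Nat.zero_le _)
      (Finset.mem_univ j)
    omega
  have hc : (abacusBeads n K).card = 4 * K := by
    have := card_abacusBeads fun j => (hK j).1
    rw [Fin.sum_univ_four] at this
    omega
  refine ⟨diagramOfBeads (abacusBeads n K) (4 * K), fun k j => ?_⟩
  rw [range_bead_diagramOfBeads hc, mem_abacusBeads]
  · have := hK j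
    omega
  · intro x hx
    obtain ⟨k, j, rfl⟩ := exists_runner x
    have h1 := mem_abacusBeads.1 hx
    have h2 := hK j
    omega
  · intro x hx
    have := le_of_mem_abacusBeads hx
    omega

/-! ### From pairs of 4-cores to six squares -/

/-- The parameters of the `4`-cores: triples of integers with even sum. -/
def coreTriples : Set (ℤ × ℤ × ℤ) := {p | (p.1 + p.2.1 + p.2.2) % 2 = 0}

/-- The size of the `4`-core with given parameters. -/
def tripleSize (p : ℤ × ℤ × ℤ) : ℤ :=
  2 * p.1 ^ 2 - 2 * p.1 + 2 * p.2.1 ^ 2 - p.2.1 + 2 * p.2.2 ^ 2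

/-- The abacus with given parameters. -/
def tripleAbacus (p : ℤ × ℤ × ℤ) : Fin 4 → ℤ :=
  let s := (p.1 + p.2.1 + p.2.2) / 2
  ![s, p.1 - s, p.2.1 - s, p.2.2 - s]

/-- The triple is (n₀+n₁, n₀+n₂, n₀+n₃), whose sum is 2n₀ because the `n j` sum to zero. In these
coordinates the quadratic part of the size is diagonal. -/
theorem exists_core_equiv : ∃ e : coreTriples ≃ {μ : YoungDiagram // IsCore 4 μ},
    ∀ p, ((e p).1.card : ℤ) = tripleSize p := by
  have hsum : ∀ p : coreTriples, tripleAbacus p 0 + tripleAbacus p 1 + tripleAbacus p 2 +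
      tripleAbacus p 3 = 0 := by
    rintro ⟨⟨a, b, c⟩, h⟩
    simp only [coreTriples, Set.mem_ofPred_eq] at h
    simp [tripleAbacus]
    omega
  choose f hf using fun p => exists_isAbacus_of_sum_eq_zero (hsum p)
  refine ⟨Equiv.ofBijective (fun p => ⟨f p, (hf p).isCore⟩) ⟨?_, ?_⟩, ?_⟩
  · rintro p q h
    have h1 : f p = f q := congrArg Subtype.val h
    have h2 := hf p
    rw [h1] at h2
    have h3 := h2.unique (hf q)
    obtain ⟨⟨a, b, c⟩, hp⟩ := p
    obtain ⟨⟨a', b', c'⟩, hq⟩ := q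
    have e0 : (a + b + c) / 2 = (a' + b' + c') / 2 := congrFun h3 0
    have e1 : a - (a + b + c) / 2 = a' - (a' + b' + c') / 2 := congrFun h3 1
    have e2 : b - (a + b + c) / 2 = b' - (a' + b' + c') / 2 := congrFun h3 2
    have e3 : c - (a + b + c) / 2 = c' - (a' + b' + c') / 2 := congrFun h3 3
    rw [Subtype.mk.injEq, Prod.mk.injEq, Prod.mk.injEq]
    omega
  · rintro ⟨μ, hμ⟩
    obtain ⟨n, hn⟩ := exists_isAbacus hμ
    have h0 := hn.sum_eq_zero
    refine ⟨⟨(n 0 + n 1, n 0 + n 2, n 0 + n 3), ?_⟩, Subtype.ext ?_⟩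
    · simp only [coreTriples, Set.mem_ofPred_eq]
      omega
    · refine (hf _).eq_of_eq ?_
      convert hn using 1
      ext j
      fin_cases j <;> simp [tripleAbacus] <;> omega
  · rintro p
    have h1 := (hf p).card_eq
    have h2 := hsum p
    change ((f p).card : ℤ) = _
    rw [h1]
    obtain ⟨⟨a, b, c⟩, h⟩ := p
    simp only [coreTriples, Set.mem_ofPred_eq] at h
    obtain ⟨s, hs⟩ : ∃ s, a + b + c = 2 * s := ⟨(a + b + c) / 2, by omega⟩
    have hs' : (a + b + c) / 2 = s := by omega
    simp [tripleAbacus, tripleSize, hs']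
    have ha : a = 2 * s - b - c := by omega
    subst ha
    ring

/-- The number of `4`-core pairs of `n` is the number of pairs of parameters of total size `n`. -/
theorem A_four_eq (n : ℕ) : A 4 n =
    {p : (ℤ × ℤ × ℤ) × (ℤ × ℤ × ℤ) | p.1 ∈ coreTriples ∧ p.2 ∈ coreTriples ∧
      tripleSize p.1 + tripleSize p.2 = n}.ncard := by
  obtain ⟨e, he⟩ := exists_core_equiv
  symm
  refine Set.ncard_congr (fun p hp => ((e ⟨p.1, hp.1⟩).1, (e ⟨p.2, hp.2.1⟩).1)) ?_ ?_ ?_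
  · rintro ⟨p, q⟩ ⟨hp, hq, h⟩
    refine ⟨?_, (e ⟨p, hp⟩).2, (e ⟨q, hq⟩).2⟩
    have h1 := he ⟨p, hp⟩
    have h2 := he ⟨q, hq⟩
    simp only at h h1 h2 ⊢
    omega
  · rintro ⟨p, q⟩ ⟨p', q'⟩ ⟨hp, hq, _⟩ ⟨hp', hq', _⟩ h
    rw [Prod.mk.injEq] at h
    have h1 := e.injective (Subtype.ext h.1)
    have h2 := e.injective (Subtype.ext h.2)
    rw [Subtype.mk.injEq] at h1 h2
    exact Prod.ext h1 h2
  · rintro ⟨μ, ν⟩ ⟨h, hμ, hν⟩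
    refine ⟨((e.symm ⟨μ, hμ⟩).1, (e.symm ⟨ν, hν⟩).1),
      ⟨(e.symm ⟨μ, hμ⟩).2, (e.symm ⟨ν, hν⟩).2, ?_⟩, by simp⟩
    have h1 := he (e.symm ⟨μ, hμ⟩)
    have h2 := he (e.symm ⟨ν, hν⟩)
    simp only [Equiv.apply_symm_apply] at h h1 h2 ⊢
    omega

theorem card_eq_two_mul_filter {α : Type*} {s : Finset α} {p : α → Prop} [DecidablePred p]
    (g : α → α) (hg : ∀ x ∈ s, g x ∈ s ∧ g (g x) = x ∧ (p (g x) ↔ ¬ p x)) :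
    s.card = 2 * (s.filter p).card := by
  have h : (s.filter p).card = (s.filter fun x => ¬ p x).card := by
    refine Finset.card_nbij' g g ?_ ?_ ?_ ?_ <;> intro x hx <;>
      simp only [Finset.coe_filter, Set.mem_ofPred_eq] at hx ⊢
    · have h1 := hg x hx.1
      have h2 := hg (g x) h1.1
      rw [h1.2.1] at h2
      exact ⟨h1.1, h2.2.2.1 hx.2⟩
    · have h1 := hg x hx.1
      exact ⟨h1.1, h1.2.2.2 hx.2⟩
    · exact (hg x hx.1).2.1
    · exact (hg x hx.1).2.1
  have := Finset.card_filter_add_card_filter_not (s := s) p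
  omega

theorem mem_sphere_iff_sum {N : ℤ} {x : Z6} : x ∈ sphere N ↔
    x 0 ^ 2 + x 1 ^ 2 + x 2 ^ 2 + x 3 ^ 2 + x 4 ^ 2 + x 5 ^ 2 = N := by
  rw [mem_sphere, dotProduct, Fin.sum_univ_six]
  simp only [sq]

/-- The vectors counted by `oddSixSquares`, normalized by sign changes and transpositions. -/
noncomputable def normalizedSixSquares (N : ℤ) : Finset Z6 :=
  (sphere N).filter fun x => (x 3 - x 2) % 4 = 0 ∧ (x 5 - x 4) % 4 = 0 ∧ (x 0 + x 1) % 4 = 3 ∧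
    (x 0 - x 1) % 4 = 3 ∧ (2 * x 2 + x 0 + x 1) % 8 = 5 ∧ (2 * x 4 + x 0 - x 1) % 8 = 5

theorem vec_eta (x : Z6) : ![x 0, x 1, x 2, x 3, x 4, x 5] = x := ofTuple_surjective x

/-- Each of six signed coordinate changes preserves the conditions imposed so far and toggles the
next one, so each halves the count. -/
theorem oddSixSquares_eq (N : ℤ) :
    oddSixSquares N = 64 * (normalizedSixSquares N).card := by
  rw [oddSixSquares,
    card_eq_two_mul_filter (p := fun x : Z6 => (x 3 - x 2) % 4 = 0)
      (fun x => ![x 0, x 1, x 2, -x 3, x 4, x 5]),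
    card_eq_two_mul_filter (p := fun x : Z6 => (x 5 - x 4) % 4 = 0)
      (fun x => ![x 0, x 1, x 2, x 3, x 4, -x 5]),
    card_eq_two_mul_filter (p := fun x : Z6 => (x 0 + x 1) % 4 = 3)
      (fun x => ![-x 1, -x 0, x 2, x 3, x 4, x 5]),
    card_eq_two_mul_filter (p := fun x : Z6 => (x 0 - x 1) % 4 = 3)
      (fun x => ![x 1, x 0, x 2, x 3, x 4, x 5]),
    card_eq_two_mul_filter (p := fun x : Z6 => (2 * x 2 + x 0 + x 1) % 8 = 5)
      (fun x => ![x 0, x 1, -x 3, -x 2, x 4, x 5]),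
    card_eq_two_mul_filter (p := fun x : Z6 => (2 * x 4 + x 0 - x 1) % 8 = 5)
      (fun x => ![x 0, x 1, x 2, x 3, -x 5, -x 4])]
  · have : ∀ s t : Finset Z6, s = t →
        2 * (2 * (2 * (2 * (2 * (2 * s.card))))) = 64 * t.card := by
      rintro s _ rfl
      ring
    refine this _ _ ?_
    ext x
    simp only [normalizedSixSquares, Finset.mem_filter, and_assoc, and_congr_right_iff]
    intro _
    constructor <;> intro h
    · tauto
    · omega
  all_goals
    intro x hx
    simp only [Finset.mem_filter, and_assoc, mem_sphere_iff_sum] at hx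
    obtain ⟨h, hx⟩ := hx
    refine ⟨?_, ?_, ?_⟩
    · simp only [Finset.mem_filter, and_assoc, mem_sphere_iff_sum]
      refine ⟨?_, ?_⟩
      · rw [← h]
        simp
        try ring
      · simp
        omega
    · simp [vec_eta]
    · simp
      omega

/-- The normalized vector attached to a pair of core parameters. -/
def tripleVector (p : (ℤ × ℤ × ℤ) × (ℤ × ℤ × ℤ)) : Z6 :=
  ![2 * (p.1.2.1 + p.2.2.1) - 1, 2 * (p.1.2.1 - p.2.2.1), 2 * p.1.1 - 1 + 2 * p.1.2.2,
    2 * p.1.1 - 1 - 2 * p.1.2.2, 2 * p.2.1 - 1 + 2 * p.2.2.2, 2 * p.2.1 - 1 - 2 * p.2.2.2]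

theorem tripleVector_injective : Function.Injective tripleVector := by
  rintro ⟨⟨a, b, c⟩, a', b', c'⟩ ⟨⟨d, e, f⟩, d', e', f'⟩ h
  have h0 := congrFun h 0
  have h1 := congrFun h 1
  have h2 := congrFun h 2
  have h3 := congrFun h 3
  have h4 := congrFun h 4
  have h5 := congrFun h 5
  simp [tripleVector] at h0 h1 h2 h3 h4 h5
  simp only [Prod.mk.injEq]
  omega

/-- Completing squares turns the pair (a, c) of each core into (2a−1+2c)² + (2a−1−2c)². The two
b-terms merge through ((4b−1)² + (4b'−1)²)/2 = (2(b+b')−1)² + (2(b−b'))². The constants add up to 5.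
-/
theorem sixtyFour_mul_A (n : ℕ) : 64 * A 4 n = oddSixSquares (4 * n + 5) := by
  rw [oddSixSquares_eq, A_four_eq, ← Set.ncard_image_of_injective _ tripleVector_injective,
    ← Set.ncard_coe_finset]
  congr 2
  ext x
  simp only [Set.mem_image, Set.mem_ofPred_eq, Finset.mem_coe, normalizedSixSquares,
    Finset.mem_filter, mem_sphere_iff_sum]
  constructor
  · rintro ⟨⟨⟨a, b, c⟩, a', b', c'⟩, ⟨h1, h2, h3⟩, rfl⟩
    simp only [coreTriples, Set.mem_ofPred_eq] at h1 h2
    simp only [tripleSize] at h3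
    simp only [tripleVector]
    refine ⟨?_, ?_⟩
    · simp
      linear_combination 4 * h3
    · simp
      omega
  · rintro ⟨h, h1, h2, h3, h4, h5, h6⟩
    obtain ⟨b, hb⟩ : ∃ b, x 0 + x 1 = 4 * b - 1 := ⟨(x 0 + x 1 + 1) / 4, by omega⟩
    obtain ⟨b', hb'⟩ : ∃ b, x 0 - x 1 = 4 * b - 1 := ⟨(x 0 - x 1 + 1) / 4, by omega⟩
    obtain ⟨a, ha⟩ : ∃ a, x 2 + x 3 = 4 * a - 2 := ⟨(x 2 + x 3 + 2) / 4, by omega⟩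
    obtain ⟨a', ha'⟩ : ∃ a, x 4 + x 5 = 4 * a - 2 := ⟨(x 4 + x 5 + 2) / 4, by omega⟩
    obtain ⟨c, hc⟩ : ∃ c, x 2 - x 3 = 4 * c := ⟨(x 2 - x 3) / 4, by omega⟩
    obtain ⟨c', hc'⟩ : ∃ c, x 4 - x 5 = 4 * c := ⟨(x 4 - x 5) / 4, by omega⟩
    have e0 : x 0 = 2 * (b + b') - 1 := by omega
    have e1 : x 1 = 2 * (b - b') := by omega
    have e2 : x 2 = 2 * a - 1 + 2 * c := by omega
    have e3 : x 3 = 2 * a - 1 - 2 * c := by omega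
    have e4 : x 4 = 2 * a' - 1 + 2 * c' := by omega
    have e5 : x 5 = 2 * a' - 1 - 2 * c' := by omega
    refine ⟨((a, b, c), (a', b', c')), ⟨?_, ?_, ?_⟩, ?_⟩
    · simp only [coreTriples, Set.mem_ofPred_eq]
      omega
    · simp only [coreTriples, Set.mem_ofPred_eq]
      omega
    · rw [e0, e1, e2, e3, e4, e5] at h
      simp only [tripleSize]
      linarith
    · rw [← vec_eta x, e0, e1, e2, e3, e4, e5]
      rfl

/-! ### Divisibility by 2 -/

/-- The number of `4`-core pairs of `3 * n + 1` is even if `3 ∤ n`. -/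
theorem two_dvd_A {n : ℕ} (hn : ¬ 3 ∣ n) : 2 ∣ A 4 (3 * n + 1) := by
  rw [A_four_eq]
  set S := {p : (ℤ × ℤ × ℤ) × (ℤ × ℤ × ℤ) | p.1 ∈ coreTriples ∧ p.2 ∈ coreTriples ∧
      tripleSize p.1 + tripleSize p.2 = (3 * n + 1 : ℕ)} with hS
  rcases S.finite_or_infinite with hfin | hinf
  swap
  · rw [hinf.ncard]
    exact dvd_zero 2
  rw [Set.ncard_eq_toFinset_card S hfin]
  -- With c = 0 a sum of two squares would equal 3(4n+3), which is divisible by 3 but not by 9.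
  have key : ∀ a b c : ℤ, ((a, b, c), (a, b, c)) ∈ S → c ≠ 0 := by
    rintro a b c ⟨-, -, h⟩ rfl
    simp only [tripleSize] at h
    push_cast at h
    have h1 : (4 * a - 2) ^ 2 + (4 * b - 1) ^ 2 = 3 * (4 * n + 3) := by
      linear_combination 4 * h
    have h2 : ∀ x : ℤ, x % 3 = 0 ∨ x ^ 2 % 3 = 1 := fun x => by
      have h3 : x % 3 = 0 ∨ x % 3 = 1 ∨ x % 3 = 2 := by omega
      rcases h3 with h3 | h3 | h3
      · exact Or.inl h3
      · right; rw [sq, Int.mul_emod, h3]; rfl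
      · right; rw [sq, Int.mul_emod, h3]; rfl
    have h4 : ∀ x : ℤ, x % 3 = 0 → x ^ 2 % 9 = 0 := fun x hx => by
      obtain ⟨y, rfl⟩ := Int.dvd_of_emod_eq_zero hx
      rw [mul_pow]
      omega
    have h5 : ∀ x : ℤ, x % 3 = 0 → x ^ 2 % 3 = 0 := fun x hx => by
      have := h4 x hx
      omega
    rcases h2 (4 * a - 2) with h6 | h6 <;> rcases h2 (4 * b - 1) with h7 | h7
    · have := h4 _ h6
      have := h4 _ h7
      omega
    · have := h5 _ h6
      omega
    · have := h5 _ h7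
      omega
    · omega
  classical
  let g : (ℤ × ℤ × ℤ) × (ℤ × ℤ × ℤ) → (ℤ × ℤ × ℤ) × (ℤ × ℤ × ℤ) := fun p =>
    if p.1 = p.2 then ((p.1.1, p.1.2.1, -p.1.2.2), (p.1.1, p.1.2.1, -p.1.2.2)) else (p.2, p.1)
  have hsum : ∑ _p ∈ hfin.toFinset, (1 : ZMod 2) = 0 := by
    refine Finset.sum_involution (fun p _ => g p) ?_ ?_ ?_ ?_
    · intro p _
      rfl
    · rintro ⟨p, q⟩ hp _ h
      simp only [g] at h
      split_ifs at h with hpq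
      · subst hpq
        obtain ⟨a, b, c⟩ := p
        have := key a b c (hfin.mem_toFinset.1 hp)
        simp only [Prod.mk.injEq] at h
        omega
      · rw [Prod.mk.injEq] at h
        exact hpq h.2
    · rintro ⟨p, q⟩ hp
      rw [Set.Finite.mem_toFinset] at hp ⊢
      obtain ⟨h1, h2, h3⟩ := hp
      simp only [g]
      split_ifs with hpq
      · subst hpq
        obtain ⟨a, b, c⟩ := p
        simp only [coreTriples, Set.mem_ofPred_eq] at h1
        refine ⟨?_, ?_, ?_⟩
        · simp only [coreTriples, Set.mem_ofPred_eq]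
          omega
        · simp only [coreTriples, Set.mem_ofPred_eq]
          omega
        · rw [← h3]
          simp only [tripleSize]
          ring
      · exact ⟨h2, h1, by rw [← h3]; exact add_comm _ _⟩
    · rintro ⟨p, q⟩ _
      simp only [g]
      by_cases hpq : p = q
      · subst hpq
        simp
      · simp [hpq, Ne.symm hpq]
  rw [Finset.sum_const, nsmul_eq_mul, mul_one] at hsum
  exact (ZMod.natCast_eq_zero_iff _ _).1 hsum

/-! ### Divisibility by 3 -/

theorem card_modEq_card_fixed {α : Type*} [DecidableEq α] {s : Finset α} (g : α → α)
    (hg : ∀ x ∈ s, g x ∈ s) (h3 : ∀ x ∈ s, g (g (g x)) = x) :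
    s.card ≡ (s.filter fun x => g x = x).card [MOD 3] := by
  let f : Function.End s := fun x => ⟨g x, hg x x.2⟩
  have hf : f ^ 3 ^ 1 = 1 := by
    funext x
    exact Subtype.ext (h3 x x.2)
  have : Fact (Nat.Prime 3) := ⟨Nat.prime_three⟩
  have h := Equiv.Perm.card_fixedPoints_modEq (p := 3) (n := 1) hf
  rw [Fintype.card_coe] at h
  rw [← Set.toFinset_card] at h
  have hcard : (Function.fixedPoints f).toFinset.card = (s.filter fun x => g x = x).card := by
    rw [← Finset.card_map (Function.Embedding.subtype (· ∈ s))]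
    congr 1
    ext x
    simp only [Finset.mem_map, Set.mem_toFinset,
      Function.Embedding.subtype_apply, Subtype.exists, Finset.mem_filter]
    constructor
    · rintro ⟨y, hy, hfix, rfl⟩
      exact ⟨hy, congrArg Subtype.val hfix⟩
    · rintro ⟨hx, hfix⟩
      exact ⟨x, hx, Subtype.ext hfix, rfl⟩
  rwa [hcard] at h

/-- The vectors of squared length `N` whose last three entries are odd and equal. -/
noncomputable def diagonalSquares (N : ℤ) : Finset Z6 :=
  (sphere N).filter fun x => x 3 % 2 = 1 ∧ x 4 = x 3 ∧ x 5 = x 3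

theorem oddSixSquares_eq_two_mul (N : ℤ) : oddSixSquares N =
    2 * ((sphere N).filter fun x => x 0 % 2 = 0 ∧ x 1 % 2 = 1 ∧ x 2 % 2 = 1 ∧ x 3 % 2 = 1 ∧
      x 4 % 2 = 1 ∧ x 5 % 2 = 1).card := by
  rw [oddSixSquares, card_eq_two_mul_filter (p := fun x : Z6 => x 0 % 2 = 0)
    (fun x => ![x 1, x 0, x 2, x 3, x 4, x 5])]
  · congr 2
    ext x
    simp only [Finset.mem_filter, and_assoc, and_congr_right_iff]
    omega
  · intro x hx
    simp only [Finset.mem_filter, mem_sphere_iff_sum] at hx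
    obtain ⟨h, hx⟩ := hx
    refine ⟨?_, ?_, ?_⟩
    · simp only [Finset.mem_filter, mem_sphere_iff_sum]
      refine ⟨?_, ?_⟩
      · rw [← h]
        simp
        ring
      · simp
        omega
    · simp [vec_eta]
    · simp
      omega

theorem card_filter_modEq_diagonal (N : ℤ) :
    ((sphere N).filter fun x => x 0 % 2 = 0 ∧ x 1 % 2 = 1 ∧ x 2 % 2 = 1 ∧ x 3 % 2 = 1 ∧
      x 4 % 2 = 1 ∧ x 5 % 2 = 1).card ≡
    ((diagonalSquares N).filter fun x => x 0 % 2 = 0 ∧ x 1 % 2 = 1 ∧ x 2 % 2 = 1).card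
      [MOD 3] := by
  refine (card_modEq_card_fixed (fun x => ![x 0, x 1, x 2, x 4, x 5, x 3]) ?_ ?_).trans ?_
  · intro x hx
    simp only [Finset.mem_filter, mem_sphere_iff_sum] at hx ⊢
    obtain ⟨h, hx⟩ := hx
    refine ⟨?_, ?_⟩
    · rw [← h]
      simp
      ring
    · simp
      omega
  · intro x _
    simp [vec_eta]
  · refine congrArg (· % 3) (congrArg Finset.card ?_)
    ext x
    simp only [diagonalSquares, Finset.mem_filter, and_assoc, and_congr_right_iff]
    intro _
    constructor
    · rintro ⟨h0, h1, h2, h3, h4, h5, h⟩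
      have e3 : x 4 = x 3 := congrFun h 3
      have e4 : x 5 = x 4 := congrFun h 4
      omega
    · rintro ⟨h3, h4, h5, h0, h1, h2⟩
      refine ⟨h0, h1, h2, h3, by omega, by omega, ?_⟩
      rw [h4, h5]
      conv_rhs => rw [← vec_eta x, h4, h5]

theorem sq_emod_three (a : ℤ) : a % 3 = 0 ∧ a ^ 2 % 3 = 0 ∨ a % 3 ≠ 0 ∧ a ^ 2 % 3 = 1 := by
  have h : a % 3 = 0 ∨ a % 3 = 1 ∨ a % 3 = 2 := by omega
  rcases h with h | h | h <;> rw [sq, Int.mul_emod, h] <;> decide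

/-- Modulo `3`, one may restrict to the vectors whose first three entries are congruent. -/
theorem card_diagonal_modEq {N : ℤ} (hN : 3 ∣ N) :
    ((diagonalSquares N).filter fun x => x 0 % 2 = 0 ∧ x 1 % 2 = 1 ∧ x 2 % 2 = 1).card ≡
    ((diagonalSquares N).filter fun x => (x 0 % 2 = 0 ∧ x 1 % 2 = 1 ∧ x 2 % 2 = 1) ∧
      (x 1 - x 0) % 3 = 0 ∧ (x 2 - x 0) % 3 = 0).card [MOD 3] := by
  set S := (diagonalSquares N).filter fun x => x 0 % 2 = 0 ∧ x 1 % 2 = 1 ∧ x 2 % 2 = 1 with hS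
  have hmod : ∀ x ∈ S, x 0 % 3 = 0 ∧ x 1 % 3 = 0 ∧ x 2 % 3 = 0 ∨
      x 0 % 3 ≠ 0 ∧ x 1 % 3 ≠ 0 ∧ x 2 % 3 ≠ 0 := fun x hx => by
    simp only [hS, diagonalSquares, Finset.mem_filter, mem_sphere_iff_sum] at hx
    obtain ⟨⟨h, -, h4, h5⟩, -⟩ := hx
    rw [h4, h5] at h
    have := sq_emod_three (x 0)
    have := sq_emod_three (x 1)
    have := sq_emod_three (x 2)
    omega
  have h1 := Finset.card_filter_add_card_filter_not (s := S) (fun x => x 0 % 3 = 0)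
  -- With none of the first three entries divisible by 3, sign changes of `x 1` and `x 2` make them
  -- congruent to `x 0` in one case out of four, and 4 ≡ 1 modulo 3.
  have h2 : (S.filter fun x => ¬ x 0 % 3 = 0).card =
      2 * (2 * (((S.filter fun x => ¬ x 0 % 3 = 0).filter fun x => (x 1 - x 0) % 3 = 0).filter
        fun x => (x 2 - x 0) % 3 = 0).card) := by
    rw [card_eq_two_mul_filter (p := fun x : Z6 => (x 1 - x 0) % 3 = 0)
        (fun x => ![x 0, -x 1, x 2, x 3, x 4, x 5]),
      card_eq_two_mul_filter (p := fun x : Z6 => (x 2 - x 0) % 3 = 0)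
        (fun x => ![x 0, x 1, -x 2, x 3, x 4, x 5])]
    all_goals
      intro x hx
      have hx' := hmod x (by simp only [Finset.mem_filter] at hx; tauto)
      simp only [hS, diagonalSquares, Finset.mem_filter, and_assoc, mem_sphere_iff_sum] at hx
      obtain ⟨h, hx⟩ := hx
      refine ⟨?_, ?_, ?_⟩
      · simp only [hS, diagonalSquares, Finset.mem_filter, and_assoc, mem_sphere_iff_sum]
        refine ⟨?_, ?_⟩
        · rw [← h]
          simp
        · simp
          omega
      · simp [vec_eta]
      · have m0 : x 0 % 3 = 1 ∨ x 0 % 3 = 2 := by omega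
        have m1 : x 1 % 3 = 1 ∨ x 1 % 3 = 2 := by omega
        have m2 : x 2 % 3 = 1 ∨ x 2 % 3 = 2 := by omega
        clear hx' hx h
        simp
        rcases m0 with m0 | m0 <;> rcases m1 with m1 | m1 <;> rcases m2 with m2 | m2 <;> omega
  have h3 := Finset.card_filter_add_card_filter_not
    (s := S.filter fun x => (x 1 - x 0) % 3 = 0 ∧ (x 2 - x 0) % 3 = 0) (fun x => x 0 % 3 = 0)
  have h4 : ((S.filter fun x => (x 1 - x 0) % 3 = 0 ∧ (x 2 - x 0) % 3 = 0).filter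
      fun x => x 0 % 3 = 0) = S.filter fun x => x 0 % 3 = 0 := by
    ext x
    simp only [Finset.mem_filter, and_assoc, and_congr_right_iff]
    intro hx
    have := hmod x hx
    omega
  have h5 : ((S.filter fun x => (x 1 - x 0) % 3 = 0 ∧ (x 2 - x 0) % 3 = 0).filter
      fun x => ¬ x 0 % 3 = 0) =
      ((S.filter fun x => ¬ x 0 % 3 = 0).filter fun x => (x 1 - x 0) % 3 = 0).filter
        fun x => (x 2 - x 0) % 3 = 0 := by
    ext x
    simp only [Finset.mem_filter]
    tauto
  rw [h4, h5] at h3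
  rw [← Finset.filter_filter, ← hS]
  unfold Nat.ModEq
  omega

/-- The representations `(α, y, g, e)` of `M` by `α ^ 2 + y ^ 2 + 2 * g ^ 2 + 6 * e ^ 2` with `α`
even, `y` odd and `g + e` odd. -/
def quaternaryVectors (M : ℤ) : Set (ℤ × ℤ × ℤ × ℤ) :=
  {p | p.1 % 2 = 0 ∧ p.2.1 % 2 = 1 ∧ (p.2.2.1 + p.2.2.2) % 2 = 1 ∧
    p.1 ^ 2 + p.2.1 ^ 2 + 2 * p.2.2.1 ^ 2 + 6 * p.2.2.2 ^ 2 = M}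

/-- Three congruent entries are written a+2g, a−g+3e, a−g−3e, with squares summing to 3a² + 6g² +
18e²; the common factor 3 then cancels. -/
theorem card_congruent_eq_ncard (M : ℤ) :
    ((diagonalSquares (3 * M)).filter fun x => (x 0 % 2 = 0 ∧ x 1 % 2 = 1 ∧ x 2 % 2 = 1) ∧
      (x 1 - x 0) % 3 = 0 ∧ (x 2 - x 0) % 3 = 0).card = (quaternaryVectors M).ncard := by
  have hinj : Function.Injective fun p : ℤ × ℤ × ℤ × ℤ =>
      (![p.1 + 2 * p.2.2.1, p.1 - p.2.2.1 + 3 * p.2.2.2, p.1 - p.2.2.1 - 3 * p.2.2.2,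
        p.2.1, p.2.1, p.2.1] : Z6) := by
    rintro ⟨a, y, g, e⟩ ⟨a', y', g', e'⟩ h
    have h0 : a + 2 * g = a' + 2 * g' := congrFun h 0
    have h1 : a - g + 3 * e = a' - g' + 3 * e' := congrFun h 1
    have h2 : a - g - 3 * e = a' - g' - 3 * e' := congrFun h 2
    have h3 : y = y' := congrFun h 3
    simp only [Prod.mk.injEq]
    omega
  rw [← Set.ncard_image_of_injective _ hinj, ← Set.ncard_coe_finset]
  congr 1
  ext x
  simp only [Set.mem_image, quaternaryVectors, Set.mem_ofPred_eq, Finset.mem_coe,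
    diagonalSquares, Finset.mem_filter, mem_sphere_iff_sum]
  constructor
  · rintro ⟨⟨h, h3, h4, h5⟩, ⟨h0, h1, h2⟩, h6, h7⟩
    obtain ⟨a, ha⟩ : ∃ a, x 0 + x 1 + x 2 = 3 * a := ⟨(x 0 + x 1 + x 2) / 3, by omega⟩
    obtain ⟨g, hg⟩ : ∃ g, x 0 - a = 2 * g := ⟨(x 0 - a) / 2, by omega⟩
    obtain ⟨e, he⟩ : ∃ e, x 1 - x 2 = 6 * e := ⟨(x 1 - x 2) / 6, by omega⟩
    have e0 : x 0 = a + 2 * g := by omega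
    have e1 : x 1 = a - g + 3 * e := by omega
    have e2 : x 2 = a - g - 3 * e := by omega
    refine ⟨(a, x 3, g, e), ⟨by simp only; omega, h3, by simp only; omega, ?_⟩, ?_⟩
    · rw [e0, e1, e2, h4, h5] at h
      simp only
      linarith
    · conv_rhs => rw [← vec_eta x, e0, e1, e2, h4, h5]
  · rintro ⟨⟨a, y, g, e⟩, ⟨h1, h2, h3, h⟩, rfl⟩
    simp only at h1 h2 h3 h
    refine ⟨⟨?_, ?_⟩, ?_⟩
    · simp
      linear_combination 3 * h
    · simp
      omega
    · simp
      omega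

/-- The same quaternary form appears through (y+a)² + (y−a)² = 2y² + 2a² and (g−3e)² + 3(g+e)² = 4g²
+ 12e². The factor 4 comes from normalizing two signs modulo 4. -/
theorem card_odd_eq_ncard (M : ℤ) :
    ((diagonalSquares (2 * M)).filter fun x => x 0 % 2 = 1 ∧ x 1 % 2 = 1 ∧ x 2 % 2 = 1).card =
      4 * (quaternaryVectors M).ncard := by
  have hinj : Function.Injective fun p : ℤ × ℤ × ℤ × ℤ =>
      (![p.2.1 + p.1, p.2.1 - p.1, p.2.2.1 - 3 * p.2.2.2, p.2.2.1 + p.2.2.2,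
        p.2.2.1 + p.2.2.2, p.2.2.1 + p.2.2.2] : Z6) := by
    rintro ⟨a, y, g, e⟩ ⟨a', y', g', e'⟩ h
    have h0 : y + a = y' + a' := congrFun h 0
    have h1 : y - a = y' - a' := congrFun h 1
    have h2 : g - 3 * e = g' - 3 * e' := congrFun h 2
    have h3 : g + e = g' + e' := congrFun h 3
    simp only [Prod.mk.injEq]
    omega
  rw [card_eq_two_mul_filter (p := fun x : Z6 => (x 0 - x 1) % 4 = 0)
      (fun x => ![x 0, -x 1, x 2, x 3, x 4, x 5]),
    card_eq_two_mul_filter (p := fun x : Z6 => (x 2 - x 3) % 4 = 0)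
      (fun x => ![x 0, x 1, -x 2, x 3, x 4, x 5]), ← mul_assoc]
  · congr 1
    rw [← Set.ncard_image_of_injective _ hinj, ← Set.ncard_coe_finset]
    congr 1
    ext x
    simp only [Set.mem_image, quaternaryVectors, Set.mem_ofPred_eq, Finset.mem_coe,
      diagonalSquares, Finset.mem_filter, mem_sphere_iff_sum]
    constructor
    · rintro ⟨⟨⟨⟨h, h3, h4, h5⟩, h0, h1, h2⟩, h6⟩, h7⟩
      obtain ⟨a, ha⟩ : ∃ a, x 0 - x 1 = 2 * a := ⟨(x 0 - x 1) / 2, by omega⟩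
      obtain ⟨e, he⟩ : ∃ e, x 3 - x 2 = 4 * e := ⟨(x 3 - x 2) / 4, by omega⟩
      have e0 : x 0 = (x 1 + a) + a := by omega
      have e1 : x 1 = (x 1 + a) - a := by omega
      have e2 : x 2 = (x 3 - e) - 3 * e := by omega
      refine ⟨(a, x 1 + a, x 3 - e, e),
        ⟨by simp only; omega, by simp only; omega, by simp only; omega, ?_⟩, ?_⟩
      · rw [e0, e2, h4, h5] at h
        simp only
        linarith
      · simp only [sub_add_cancel, add_sub_cancel_right]
        conv_rhs => rw [← vec_eta x, e0, e2, h4, h5]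
    · rintro ⟨⟨a, y, g, e⟩, ⟨h1, h2, h3, h⟩, rfl⟩
      simp only at h1 h2 h3 h
      refine ⟨⟨⟨⟨?_, ?_⟩, ?_⟩, ?_⟩, ?_⟩
      · simp
        linear_combination 2 * h
      all_goals
        simp
        omega
  all_goals
    intro x hx
    simp only [diagonalSquares, Finset.mem_filter, and_assoc, mem_sphere_iff_sum] at hx
    obtain ⟨h, hx⟩ := hx
    refine ⟨?_, ?_, ?_⟩
    · simp only [diagonalSquares, Finset.mem_filter, and_assoc, mem_sphere_iff_sum]
      refine ⟨?_, ?_⟩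
      · rw [← h]
        simp
      · simp
        omega
    · simp [vec_eta]
    · simp
      omega

/-- Cycling the first three entries has no fixed point: one would give 3x² + 3y² = 2M. -/
theorem three_dvd_card_odd {M : ℤ} (hM : ¬ 3 ∣ M) :
    3 ∣ ((diagonalSquares (2 * M)).filter fun x =>
      x 0 % 2 = 1 ∧ x 1 % 2 = 1 ∧ x 2 % 2 = 1).card := by
  have h := card_modEq_card_fixed (s := (diagonalSquares (2 * M)).filter fun x =>
    x 0 % 2 = 1 ∧ x 1 % 2 = 1 ∧ x 2 % 2 = 1) (fun x => ![x 1, x 2, x 0, x 3, x 4, x 5]) ?_ ?_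
  · refine (Nat.modEq_zero_iff_dvd).1 (h.trans ?_)
    rw [Finset.filter_eq_empty_iff.2, Finset.card_empty]
    · intro x hx hfix
      simp only [diagonalSquares, Finset.mem_filter, mem_sphere_iff_sum] at hx
      obtain ⟨⟨h, -, h4, h5⟩, -⟩ := hx
      have e0 : x 1 = x 0 := congrFun hfix 0
      have e1 : x 2 = x 1 := congrFun hfix 1
      rw [e1, e0, h4, h5] at h
      omega
  · intro x hx
    simp only [diagonalSquares, Finset.mem_filter, mem_sphere_iff_sum] at hx ⊢
    obtain ⟨⟨h, hx⟩, hx'⟩ := hx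
    refine ⟨⟨?_, ?_⟩, ?_⟩
    · rw [← h]
      simp
      ring
    · simp
      omega
    · simp
      omega
  · intro x _
    simp [vec_eta]

theorem three_dvd_oddSixSquares {M : ℤ} (hM : ¬ 3 ∣ M) : 3 ∣ oddSixSquares (3 * M) := by
  have h1 := three_dvd_card_odd hM
  rw [card_odd_eq_ncard] at h1
  have h2 := ((card_filter_modEq_diagonal (3 * M)).trans
    (card_diagonal_modEq (dvd_mul_right 3 M)))
  rw [card_congruent_eq_ncard] at h2
  rw [oddSixSquares_eq_two_mul]
  unfold Nat.ModEq at h2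
  omega

theorem six_dvd_A {n : ℕ} (hn : ¬ 3 ∣ n) : 6 ∣ A 4 (3 * n + 1) := by
  have h3 := three_dvd_oddSixSquares (M := 4 * n + 3) (by omega)
  have h := sixtyFour_mul_A (3 * n + 1)
  rw [show (4 * ((3 * n + 1 : ℕ) : ℤ) + 5) = 3 * (4 * n + 3) by push_cast; ring] at h
  have := two_dvd_A hn
  omega

/-! ### The index arithmetic and the conclusion -/

theorem four_mul_index (n k : ℕ) :
    4 * (3 ^ (2 * k + 1) * n + (3 ^ (2 * k + 2) - 5) / 4) + 5 = 9 ^ k * (3 * (4 * n + 3)) := by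
  have h1 : 3 ^ (2 * k + 2) = 9 * 9 ^ k := by
    rw [pow_add, pow_mul]
    ring
  have h2 : 3 ^ (2 * k + 1) = 3 * 9 ^ k := by
    rw [pow_add, pow_mul]
    ring
  -- This makes the division by 4 exact; the truncated subtraction is harmless since 9·9^k ≥ 9.
  have h3 : 9 ^ k % 4 = 1 := by
    rw [Nat.pow_mod]
    simp
  have h4 : 1 ≤ 9 ^ k := Nat.one_le_pow _ _ (by norm_num)
  rw [h1, h2]
  have h5 : 9 ^ k * (3 * (4 * n + 3)) = 4 * (3 * 9 ^ k * n) + 9 * 9 ^ k := by ring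
  omega

theorem eighty_mul_A {n : ℕ} (hn : ¬ 3 ∣ n) (k : ℕ) :
    80 * (A 4 (3 ^ (2 * k + 1) * n + (3 ^ (2 * k + 2) - 5) / 4) : ℤ) =
      (3 ^ (4 * k + 4) - 1) * A 4 (3 * n + 1) := by
  have h := oddSixSquares_recurrence (M := 4 * n + 3) (by omega) k
  have h1 := sixtyFour_mul_A (3 ^ (2 * k + 1) * n + (3 ^ (2 * k + 2) - 5) / 4)
  have h2 := sixtyFour_mul_A (3 * n + 1)
  rw [show (4 * ((3 * n + 1 : ℕ) : ℤ) + 5) = 3 * (4 * n + 3) by push_cast; ring] at h2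
  have h3 : (4 * ((3 ^ (2 * k + 1) * n + (3 ^ (2 * k + 2) - 5) / 4 : ℕ) : ℤ) + 5) =
      9 ^ k * (3 * (4 * n + 3)) := by exact_mod_cast four_mul_index n k
  rw [h3] at h1
  rw [← h1, ← h2] at h
  have h4 : (3 : ℤ) ^ (4 * k + 4) = 81 ^ (k + 1) := by
    rw [show 4 * k + 4 = 4 * (k + 1) by ring, pow_mul]
    norm_num
  rw [h4]
  push_cast at h ⊢
  linarith

end CorePairs

theorem theorem1p2 (n k : ℕ) (hn : ¬ 3 ∣ n) :
    (CorePairs.A 4 (3 ^ (2 * k + 1) * n + (3 ^ (2 * k + 2) - 5) / 4) : ℚ) =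
        ((3 : ℚ) ^ (4 * k + 4) - 1) / 80 * (CorePairs.A 4 (3 * n + 1) : ℚ) ∧
      CorePairs.A 4 (3 ^ (2 * k + 1) * n + (3 ^ (2 * k + 2) - 5) / 4) ≡ 0
        [MOD 3 * (3 ^ (4 * k + 4) - 1) / 40] := by
  have h := CorePairs.eighty_mul_A hn k
  constructor
  · have h' : (80 * (CorePairs.A 4 (3 ^ (2 * k + 1) * n + (3 ^ (2 * k + 2) - 5) / 4)) : ℚ) =
        (3 ^ (4 * k + 4) - 1) * CorePairs.A 4 (3 * n + 1) := by exact_mod_cast h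
    linarith
  · obtain ⟨c, hc⟩ := CorePairs.six_dvd_A hn
    obtain ⟨d, hd⟩ : 80 ∣ 3 ^ (4 * k + 4) - 1 := by
      have := Nat.sub_dvd_pow_sub_pow 81 1 (k + 1)
      rwa [one_pow, show 81 ^ (k + 1) = 3 ^ (4 * k + 4) by
        rw [show 4 * k + 4 = 4 * (k + 1) by ring, pow_mul]; norm_num] at this
    have hpos : 1 ≤ 3 ^ (4 * k + 4) := Nat.one_le_pow _ _ (by norm_num)
    have hd' : ((3 : ℤ) ^ (4 * k + 4) - 1) = 80 * d := by
      have : (3 : ℕ) ^ (4 * k + 4) = 80 * d + 1 := by omega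
      have : (3 : ℤ) ^ (4 * k + 4) = 80 * d + 1 := by exact_mod_cast this
      linarith
    -- The modulus is 6d and the count is d·A₄(3n+1), so 6 ∣ A₄(3n+1) suffices.
    rw [hd, show 3 * (80 * d) / 40 = 6 * d by omega, Nat.modEq_zero_iff_dvd]
    refine ⟨c, ?_⟩
    rw [hd', hc] at h
    zify
    push_cast at h
    linarith
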